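/- All rings are associative with identity and all modules are unitary. Let $A$ and $B$ be rings, let $U$ be a $(B,A)$-bimodule, and let $T=\begin{pmatrix}A&0\\U&B\end{pmatrix}$ be the triangular matrix ring. A left $T$-module is identified with a triple $M=\binom{M_1}{M_2}_{\varphi}$, where $M_1$ is a left $A$-module, $M_2$ is a left $B$-module and $\varphi:U\otimes_A M_1\to M_2$ is a $B$-homomorphism; the action is $\begin{pmatrix}a&0\\u&b\end{pmatrix}\binom{m_1}{m_2}=\binom{am_1}{\varphi(u\otimes m_1)+bm_2}$. A left $R$-module $G$ is Gorenstein projective if there is an exact sequence $\cdots\to P^{-1}\to P^0\to P^1\to\cdots$ of projective left $R$-modules that stays exact under $\mathrm{Hom}_R(-,Q)$ for every projective left $R$-module $Q$ and satisfies $G\cong\mathrm{Ker}(P^0\to P^1)$. The Gorenstein projective dimension $\mathrm{Gpd}(X)$ of a left $R$-module $X$ is the least $m\ge 0$ for which there is an exact sequence $0\to G_m\to\cdots\to G_0\to X\to0$ with all $G_i$ Gorenstein projective, and $\infty$ if there is no such $m$. A ring $R$ is left Gorenstein regular if in the category of left $R$-modules (1) the modules of finite projective dimension are exactly those of finite injective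 dimension, (2) the finitistic projective and injective dimensions are finite, and (3) there is a generator of finite projective dimension. Proposition. Let $n\ge 0$ be an integer. Assume that $B$ is left Gorenstein regular, that $U$ has finite flat dimension as a right $A$-module, and that $U$ is projective as a left $B$-module. Let $M=\binom{M_1}{M_2}_{\varphi}$ be a left $T$-module such that $\mathrm{Gpd}(M_1)\le n$ over $A$, $\mathrm{Gpd}(M_2)\le n$ over $B$, and the left $B$-module $U\otimes_A M_1$ has finite projective dimension. Then $\mathrm{Gpd}(M)\le n+1$ over $T$. -/

import Mathlib

universe u

noncomputable section

namespace GorensteinTriangular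

open CategoryTheory MulOpposite
open scoped TensorProduct

/-! ### The tensor product over a noncommutative ring -/

section Tensor

variable (A : Type u) [Ring A]
variable (U : Type u) [AddCommGroup U] [Module Aᵐᵒᵖ U]
variable (M : Type u) [AddCommGroup M] [Module A M]

/-- The subgroup of `U ⊗[ℤ] M` generated by the elements `(u a) ⊗ m - u ⊗ (a m)`. Right
`A`-modules are modules over `Aᵐᵒᵖ`, so that `op a • u` is `u a`. -/
def balancedRel : AddSubgroup (U ⊗[ℤ] M) :=
  AddSubgroup.closure {x | ∃ (u : U) (a : A) (m : M), x = (op a • u) ⊗ₜ[ℤ] m - u ⊗ₜ[ℤ] (a • m)}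

/-- The abelian group `U ⊗_A M`, for a right `A`-module `U` and a left `A`-module `M`. -/
def Tens : Type u := (U ⊗[ℤ] M) ⧸ balancedRel A U M

instance : AddCommGroup (Tens A U M) :=
  inferInstanceAs (AddCommGroup ((U ⊗[ℤ] M) ⧸ balancedRel A U M))

variable {U M}

/-- The pure tensor `u ⊗ m` in `U ⊗_A M`. -/
def tmul (u : U) (m : M) : Tens A U M := QuotientAddGroup.mk' (balancedRel A U M) (u ⊗ₜ[ℤ] m)

variable {A}

theorem Tens.induction {p : Tens A U M → Prop} (h0 : p 0)
    (ht : ∀ u m, p (tmul A u m)) (ha : ∀ x y, p x → p y → p (x + y)) (x : Tens A U M) : p x := by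
  obtain ⟨y, rfl⟩ := QuotientAddGroup.mk'_surjective (balancedRel A U M) x
  induction y using TensorProduct.induction_on with
  | zero => rw [map_zero]; exact h0
  | tmul u m => exact ht u m
  | add x y hx hy => rw [map_add]; exact ha _ _ hx hy

theorem tmul_add (u : U) (m m' : M) : tmul A u (m + m') = tmul A u m + tmul A u m' := by
  unfold tmul; rw [TensorProduct.tmul_add]; exact map_add _ _ _

theorem add_tmul (u u' : U) (m : M) : tmul A (u + u') m = tmul A u m + tmul A u' m := by
  unfold tmul; rw [TensorProduct.add_tmul]; exact map_add _ _ _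

theorem tmul_zero (u : U) : tmul A u (0 : M) = 0 := by
  unfold tmul; rw [TensorProduct.tmul_zero]; exact map_zero _

theorem zero_tmul (m : M) : tmul A (0 : U) m = 0 := by
  unfold tmul; rw [TensorProduct.zero_tmul]; exact map_zero _

theorem op_smul_tmul (u : U) (a : A) (m : M) : tmul A (op a • u) m = tmul A u (a • m) := by
  unfold tmul
  refine (QuotientAddGroup.eq_iff_sub_mem (N := balancedRel A U M)).2
    (AddSubgroup.subset_closure ⟨u, a, m, rfl⟩)

/-- The additive map `g ⊗_A f : U ⊗_A M → U' ⊗_A M'`. -/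
def Tens.map {U' M' : Type u} [AddCommGroup U'] [Module Aᵐᵒᵖ U'] [AddCommGroup M'] [Module A M']
    (g : U →ₗ[Aᵐᵒᵖ] U') (f : M →ₗ[A] M') : Tens A U M →+ Tens A U' M' :=
  QuotientAddGroup.map (balancedRel A U M) (balancedRel A U' M')
    (TensorProduct.map g.toAddMonoidHom.toIntLinearMap
      f.toAddMonoidHom.toIntLinearMap).toAddMonoidHom (by
      refine (AddSubgroup.closure_le _).2 ?_
      rintro _ ⟨u, a, m, rfl⟩
      refine AddSubgroup.subset_closure ⟨g u, a, f m, ?_⟩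
      simp)

theorem Tens.map_tmul {U' M' : Type u} [AddCommGroup U'] [Module Aᵐᵒᵖ U'] [AddCommGroup M']
    [Module A M'] (g : U →ₗ[Aᵐᵒᵖ] U') (f : M →ₗ[A] M') (u : U) (m : M) :
    Tens.map g f (tmul A u m) = tmul A (g u) (f m) := rfl

variable {B : Type u} [Ring B] [Module B U] [SMulCommClass B Aᵐᵒᵖ U]

/-- Left multiplication by `b : B` on a `(B, A)`-bimodule `U`, as a map of right `A`-modules. -/
def leftMul (U : Type u) [AddCommGroup U] [Module Aᵐᵒᵖ U] [Module B U] [SMulCommClass B Aᵐᵒᵖ U]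
    (b : B) : U →ₗ[Aᵐᵒᵖ] U where
  toFun u := b • u
  map_add' := smul_add b
  map_smul' c u := smul_comm b c u

/-- For a `(B, A)`-bimodule `U`, the group `U ⊗_A M` is a left `B`-module by
`b (u ⊗ m) = (b u) ⊗ m`. -/
instance : Module B (Tens A U M) where
  smul b := Tens.map (leftMul U b) LinearMap.id
  smul_zero _ := map_zero _
  smul_add _ := map_add _
  one_smul x := by
    change Tens.map (leftMul U (1 : B)) LinearMap.id x = x
    induction x using Tens.induction with
    | h0 => exact map_zero _
    | ht u m => rw [Tens.map_tmul]; exact congrArg (fun v => tmul A v m) (one_smul B u)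
    | ha x y hx hy => rw [map_add, hx, hy]
  mul_smul b c x := by
    change Tens.map (leftMul U (b * c)) LinearMap.id x =
      Tens.map (leftMul U b) LinearMap.id (Tens.map (leftMul U c) LinearMap.id x)
    induction x using Tens.induction with
    | h0 => simp
    | ht u m =>
      simp only [Tens.map_tmul]
      exact congrArg (fun v => tmul A v m) (mul_smul b c u)
    | ha x y hx hy => simp only [map_add, hx, hy]
  add_smul b c x := by
    change Tens.map (leftMul U (b + c)) LinearMap.id x =
      Tens.map (leftMul U b) LinearMap.id x + Tens.map (leftMul U c) LinearMap.id x
    induction x using Tens.induction with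
    | h0 => simp
    | ht u m =>
      simp only [Tens.map_tmul, ← add_tmul]
      exact congrArg (fun v => tmul A v m) (add_smul b c u)
    | ha x y hx hy => simp only [map_add, hx, hy]; abel
  zero_smul x := by
    change Tens.map (leftMul U (0 : B)) LinearMap.id x = 0
    induction x using Tens.induction with
    | h0 => exact map_zero _
    | ht u m =>
      rw [Tens.map_tmul]
      exact (congrArg (fun v => tmul A v m) (zero_smul B u)).trans (zero_tmul m)
    | ha x y hx hy => rw [map_add, hx, hy, add_zero]

theorem smul_tmul (b : B) (u : U) (m : M) : b • tmul A u m = tmul A (b • u) m := rfl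

end Tensor

/-! ### Dimensions defined by resolutions -/

/-- `HasResolution C n M`: there is an exact sequence `0 → Xₙ → ⋯ → X₁ → X₀ → M → 0` with all `Xᵢ`
in the class `C` (closed under isomorphism). For positive length this says that some `X` in `C`
maps onto `M` with a kernel that has such a resolution of length one less. -/
def HasResolution {R : Type u} [Ring R] (C : ModuleCat.{u} R → Prop) :
    ℕ → ModuleCat.{u} R → Prop
  | 0, M => C M
  | n + 1, M => ∃ (X : ModuleCat.{u} R) (f : X →ₗ[R] M), C X ∧ Function.Surjective f ∧
      HasResolution C n (ModuleCat.of R (LinearMap.ker f))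

/-- The least length of a resolution of `M` by modules in `C`, and `⊤` if there is none. -/
def resolutionDim {R : Type u} [Ring R] (C : ModuleCat.{u} R → Prop) (M : ModuleCat.{u} R) : ℕ∞ :=
  ⨅ (n : ℕ) (_ : HasResolution C n M), (n : ℕ∞)

/-- A right `A`-module `U` is flat if `U ⊗_A -` preserves injectivity of maps of left
`A`-modules. -/
def IsRightFlat (A : Type u) [Ring A] (U : ModuleCat.{u} Aᵐᵒᵖ) : Prop :=
  ∀ (M N : ModuleCat.{u} A) (f : M →ₗ[A] N), Function.Injective f →
    Function.Injective (Tens.map (A := A) (LinearMap.id : U →ₗ[Aᵐᵒᵖ] U) f)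

/-- The flat dimension of a right `A`-module `U`. -/
def rightFlatDim (A : Type u) [Ring A] (U : Type u) [AddCommGroup U] [Module Aᵐᵒᵖ U] : ℕ∞ :=
  resolutionDim (IsRightFlat A) (ModuleCat.of Aᵐᵒᵖ U)

/-- A left `R`-module `M` is Gorenstein projective if there is an exact sequence
`⋯ → P (-1) → P 0 → P 1 → ⋯` of projective left `R`-modules that stays exact under `Hom_R(-, Q)`
for every projective left `R`-module `Q`, with `M` isomorphic to the kernel of `P 0 → P 1`. -/
def IsGorensteinProjective {R : Type u} [Ring R] (M : ModuleCat.{u} R) : Prop :=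
  ∃ (P : ℤ → ModuleCat.{u} R) (d : ∀ i : ℤ, P i →ₗ[R] P (i + 1)),
    (∀ i, Module.Projective R (P i)) ∧
    (∀ i, Function.Exact (d i) (d (i + 1))) ∧
    (∀ Q : ModuleCat.{u} R, Module.Projective R Q → ∀ i,
      Function.Exact (fun g : P (i + 1 + 1) →ₗ[R] Q => g ∘ₗ d (i + 1))
        (fun g : P (i + 1) →ₗ[R] Q => g ∘ₗ d i)) ∧
    Nonempty (M ≃ₗ[R] LinearMap.ker (d 0))

/-- The Gorenstein projective dimension of a left `R`-module: the least length of a resolution by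
Gorenstein projective modules, and `⊤` if there is no finite one. -/
def Gpd (R : Type u) [Ring R] (M : Type u) [AddCommGroup M] [Module R M] : ℕ∞ :=
  resolutionDim IsGorensteinProjective (ModuleCat.of R M)

/-! ### Gorenstein regular rings -/

/-- A Grothendieck category is Gorenstein if the objects of finite projective dimension are those
of finite injective dimension, the finitistic projective and injective dimensions are finite, and
there is a generator of finite projective dimension. -/
structure IsGorensteinCategory (C : Type*) [Category* C] [Abelian C]
    [IsGrothendieckAbelian.{u} C] : Prop where
  finite_iff : ∀ X : C, projectiveDimension X ≠ ⊤ ↔ injectiveDimension X ≠ ⊤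
  finitistic_projective : ∃ n : ℕ, ∀ X : C, projectiveDimension X ≠ ⊤ → projectiveDimension X ≤ n
  finitistic_injective : ∃ n : ℕ, ∀ X : C, injectiveDimension X ≠ ⊤ → injectiveDimension X ≤ n
  exists_generator : ∃ G : C, IsSeparator G ∧ projectiveDimension G ≠ ⊤

/-- A ring is left Gorenstein regular if its category of left modules is Gorenstein. -/
def IsLeftGorensteinRegular (R : Type u) [Ring R] : Prop :=
  IsGorensteinCategory.{u} (ModuleCat.{u} R)

/-! ### The triangular matrix ring and its modules -/

/-- The underlying set of the triangular matrix ring `(A 0; U B)`. -/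
@[ext] structure TriangularRing (A B U : Type u) : Type u where
  a : A
  u : U
  b : B

section Triangular

variable {A B U : Type u} [Ring A] [Ring B] [AddCommGroup U]

namespace TriangularRing

instance : Zero (TriangularRing A B U) := ⟨⟨0, 0, 0⟩⟩
instance : One (TriangularRing A B U) := ⟨⟨1, 0, 1⟩⟩
instance : Add (TriangularRing A B U) := ⟨fun s t => ⟨s.a + t.a, s.u + t.u, s.b + t.b⟩⟩
instance : Neg (TriangularRing A B U) := ⟨fun s => ⟨-s.a, -s.u, -s.b⟩⟩

@[simp] theorem zero_a : (0 : TriangularRing A B U).a = 0 := rfl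
@[simp] theorem zero_u : (0 : TriangularRing A B U).u = 0 := rfl
@[simp] theorem zero_b : (0 : TriangularRing A B U).b = 0 := rfl
@[simp] theorem one_a : (1 : TriangularRing A B U).a = 1 := rfl
@[simp] theorem one_u : (1 : TriangularRing A B U).u = 0 := rfl
@[simp] theorem one_b : (1 : TriangularRing A B U).b = 1 := rfl
@[simp] theorem add_a (s t : TriangularRing A B U) : (s + t).a = s.a + t.a := rfl
@[simp] theorem add_u (s t : TriangularRing A B U) : (s + t).u = s.u + t.u := rfl
@[simp] theorem add_b (s t : TriangularRing A B U) : (s + t).b = s.b + t.b := rfl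
@[simp] theorem neg_a (s : TriangularRing A B U) : (-s).a = -s.a := rfl
@[simp] theorem neg_u (s : TriangularRing A B U) : (-s).u = -s.u := rfl
@[simp] theorem neg_b (s : TriangularRing A B U) : (-s).b = -s.b := rfl

variable [Module B U] [Module Aᵐᵒᵖ U]

/-- Matrix multiplication:
`(a 0; u b) (a' 0; u' b') = (a a' 0; u a' + b u' b b')`. -/
instance : Mul (TriangularRing A B U) :=
  ⟨fun s t => ⟨s.a * t.a, op t.a • s.u + s.b • t.u, s.b * t.b⟩⟩

@[simp] theorem mul_a (s t : TriangularRing A B U) : (s * t).a = s.a * t.a := rfl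
@[simp] theorem mul_u (s t : TriangularRing A B U) :
    (s * t).u = op t.a • s.u + s.b • t.u := rfl
@[simp] theorem mul_b (s t : TriangularRing A B U) : (s * t).b = s.b * t.b := rfl

instance [SMulCommClass B Aᵐᵒᵖ U] : Ring (TriangularRing A B U) where
  add_assoc s t r := by ext <;> simp [add_assoc]
  zero_add s := by ext <;> simp
  add_zero s := by ext <;> simp
  add_comm s t := by ext <;> simp [add_comm]
  neg_add_cancel s := by ext <;> simp
  left_distrib s t r := by
    ext <;> simp [mul_add, add_smul, smul_add]
    abel
  right_distrib s t r := by
    ext <;> simp [add_mul, add_smul, smul_add]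
    abel
  zero_mul s := by ext <;> simp
  mul_zero s := by ext <;> simp
  mul_assoc s t r := by
    ext <;> simp [mul_assoc, mul_smul, smul_add, add_assoc, smul_comm]
  one_mul s := by ext <;> simp
  mul_one s := by ext <;> simp
  nsmul := nsmulRec
  zsmul := zsmulRec

end TriangularRing

variable [Module B U] [Module Aᵐᵒᵖ U] [SMulCommClass B Aᵐᵒᵖ U]
variable {M₁ M₂ : Type u} [AddCommGroup M₁] [Module A M₁] [AddCommGroup M₂] [Module B M₂]

/-- The left module over `(A 0; U B)` given by a left `A`-module `M₁`, a left `B`-module `M₂` and a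
`B`-linear map `φ : U ⊗_A M₁ → M₂`. Its elements are the columns `(m₁; m₂)`. -/
def TriangularModule (_φ : Tens A U M₁ →ₗ[B] M₂) : Type u := M₁ × M₂

variable (φ : Tens A U M₁ →ₗ[B] M₂)

instance : AddCommGroup (TriangularModule φ) := inferInstanceAs (AddCommGroup (M₁ × M₂))

/-- The action is `(a 0; u b) (m₁; m₂) = (a m₁; φ (u ⊗ m₁) + b m₂)`. -/
instance : Module (TriangularRing A B U) (TriangularModule φ) where
  smul t m := (t.a • m.1, φ (tmul A t.u m.1) + t.b • m.2)
  smul_zero t := by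
    change ((t.a • (0 : M₁), φ (tmul A t.u (0 : M₁)) + t.b • (0 : M₂)) : M₁ × M₂) = 0
    simp [tmul_zero]
  smul_add t m m' := by
    change ((t.a • (m.1 + m'.1), φ (tmul A t.u (m.1 + m'.1)) + t.b • (m.2 + m'.2)) : M₁ × M₂) =
      (t.a • m.1 + t.a • m'.1,
        (φ (tmul A t.u m.1) + t.b • m.2) + (φ (tmul A t.u m'.1) + t.b • m'.2))
    refine Prod.ext (smul_add _ _ _) ?_
    simp only [tmul_add, map_add, smul_add]
    abel
  one_smul m := by
    change (((1 : A) • m.1, φ (tmul A (0 : U) m.1) + (1 : B) • m.2) : M₁ × M₂) = m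
    simp only [one_smul, zero_tmul, map_zero, zero_add]
    rfl
  mul_smul s t m := by
    change (((s.a * t.a) • m.1,
        φ (tmul A (op t.a • s.u + s.b • t.u) m.1) + (s.b * t.b) • m.2) : M₁ × M₂) =
      (s.a • t.a • m.1,
        φ (tmul A s.u (t.a • m.1)) + s.b • (φ (tmul A t.u m.1) + t.b • m.2))
    refine Prod.ext (mul_smul _ _ _) ?_
    simp only [add_tmul, op_smul_tmul, ← smul_tmul, map_add, map_smul, smul_add, mul_smul,
      add_assoc]
  add_smul s t m := by
    change (((s.a + t.a) • m.1, φ (tmul A (s.u + t.u) m.1) + (s.b + t.b) • m.2) : M₁ × M₂) =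
      (s.a • m.1 + t.a • m.1,
        (φ (tmul A s.u m.1) + s.b • m.2) + (φ (tmul A t.u m.1) + t.b • m.2))
    refine Prod.ext (add_smul _ _ _) ?_
    simp only [add_tmul, map_add, add_smul]
    abel
  zero_smul m := by
    change (((0 : A) • m.1, φ (tmul A (0 : U) m.1) + (0 : B) • m.2) : M₁ × M₂) = 0
    simp [zero_tmul]

end Triangular

end GorensteinTriangular

end

open CategoryTheory GorensteinTriangular

/-! Gorenstein projective modules over `T` are built from columns. Applying `X ↦ (X; U ⊗ X)` to a
totally acyclic complex over `A` gives an exact complex of projectives because `U` has finite flat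
dimension. By adjunction, maps from it into a projective `T`-module `Q` are maps into the first
component of `Q`, which is projective over `A`. So `(G; U ⊗ G)` is Gorenstein projective when `G` is
(`IsGorensteinProjective.induced`). The same argument works for `(0; Y)`, since the second component
of `Q` is projective over `B` when `U` is (`IsGorensteinProjective.inflated`). Closure under
extensions then gives the covers `(G; (U ⊗ G) ⊕ Q)`.

Over a Gorenstein regular ring every exact complex of projectives is totally acyclic, since
projectives have finite injective dimension. Hence `U ⊗ G` is Gorenstein projective over `B`
(`IsGorensteinProjective.tens`).

The bound follows by induction on `n`. If `M₁` and `M₂` are Gorenstein projective, the cover `(M₁;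
(U ⊗ M₁) ⊕ M₂)` maps onto `M` with kernel `(0; U ⊗ M₁)`, which costs the extra step. Otherwise, for
surjections `G → M₁` and `Q → M₂`, the kernel of the cover has first component the syzygy of `M₁`
and second component an extension of `U ⊗ G` by the syzygy of `M₂`. By `HasResolution.extension`
both have resolutions of length one less. -/

namespace GorensteinTriangular

open MulOpposite
open scoped TensorProduct

/-! ### Factoring linear maps through surjections and injections -/

section Factorization

variable {R : Type*} [Ring R] {X Y Z : Type*} [AddCommGroup X] [Module R X] [AddCommGroup Y]
  [Module R Y] [AddCommGroup Z] [Module R Z]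

theorem exists_factor_surjective (p : X →ₗ[R] Y) (hp : Function.Surjective p) (g : X →ₗ[R] Z)
    (h : ∀ x, p x = 0 → g x = 0) : ∃ k : Y →ₗ[R] Z, ∀ x, k (p x) = g x := by
  refine ⟨(LinearMap.ker p).liftQ g (fun x hx => h x hx) ∘ₗ
    (p.quotKerEquivOfSurjective hp).symm.toLinearMap, fun x => ?_⟩
  have : (p.quotKerEquivOfSurjective hp).symm (p x) = Submodule.Quotient.mk x := by
    rw [LinearEquiv.symm_apply_eq]; rfl
  rw [LinearMap.comp_apply, LinearEquiv.coe_coe, this]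
  rfl

theorem exists_factor_injective (i : Y →ₗ[R] Z) (hi : Function.Injective i) (g : X →ₗ[R] Z)
    (h : ∀ x, ∃ y, i y = g x) : ∃ k : X →ₗ[R] Y, ∀ x, i (k x) = g x := by
  refine ⟨(LinearEquiv.ofInjective i hi).symm.toLinearMap ∘ₗ
    g.codRestrict (LinearMap.range i) (fun x => h x), fun x => ?_⟩
  have := LinearEquiv.apply_symm_apply (LinearEquiv.ofInjective i hi)
    (g.codRestrict (LinearMap.range i) (fun x => h x) x)
  exact congrArg Subtype.val this

end Factorization

/-! ### Gorenstein projective modules: steps, closure under extensions, resolutions -/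

section GorensteinProjective

variable {R : Type u} [Ring R]

/-- `ProjectiveStep X P Y ι π`: a short exact sequence `0 → X → P → Y → 0` with `P` projective. -/
structure ProjectiveStep (X P Y : Type u) [AddCommGroup X] [Module R X] [AddCommGroup P]
    [Module R P] [AddCommGroup Y] [Module R Y] (ι : X →ₗ[R] P) (π : P →ₗ[R] Y) : Prop where
  projective : Module.Projective R P
  injective : Function.Injective ι
  surjective : Function.Surjective π
  exact : Function.Exact ι π

/-- There is a short exact sequence `0 → X → P → Y → 0` with `P` projective such that every map
from `X` to a projective module extends to `P`. -/
def GorensteinStep (X Y : ModuleCat.{u} R) : Prop :=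
  ∃ (P : ModuleCat.{u} R) (ι : X →ₗ[R] P) (π : P →ₗ[R] Y), ProjectiveStep X P Y ι π ∧
    ∀ Q : ModuleCat.{u} R, Module.Projective R Q → ∀ g : X →ₗ[R] Q,
      ∃ h : P →ₗ[R] Q, ∀ x, h (ι x) = g x

theorem GorensteinStep.congr_left {X X' Y : ModuleCat.{u} R} (e : X' ≃ₗ[R] X)
    (h : GorensteinStep X Y) : GorensteinStep X' Y := by
  obtain ⟨P, ι, π, s, hext⟩ := h
  refine ⟨P, ι ∘ₗ e.toLinearMap, π, ⟨s.1, s.2.comp e.injective, s.3, fun p => ?_⟩,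
    fun Q hQ g => ?_⟩
  · rw [s.exact p]
    exact ⟨fun ⟨x, hx⟩ => ⟨e.symm x, by simp [hx]⟩, fun ⟨x, hx⟩ => ⟨e x, hx⟩⟩
  · obtain ⟨h, hh⟩ := hext Q hQ (g ∘ₗ e.symm.toLinearMap)
    exact ⟨h, fun x => by simp [hh]⟩

theorem GorensteinStep.congr_right {X Y Y' : ModuleCat.{u} R} (e : Y ≃ₗ[R] Y')
    (h : GorensteinStep X Y) : GorensteinStep X Y' := by
  obtain ⟨P, ι, π, s, hext⟩ := h
  refine ⟨P, ι, e.toLinearMap ∘ₗ π, ⟨s.1, s.2, e.surjective.comp s.3, fun p => ?_⟩, hext⟩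
  rw [← s.exact p]; simp

/-- Splicing the short exact sequences gives the complex. Total acyclicity becomes the local
condition that maps from each cycle module to a projective extend, so later constructions can treat
one step at a time. -/
theorem IsGorensteinProjective.of_family (X : ℤ → ModuleCat.{u} R)
    (hX : ∀ i, GorensteinStep (X i) (X (i + 1))) (M : ModuleCat.{u} R) (e : M ≃ₗ[R] X 0) :
    IsGorensteinProjective M := by
  choose P ι π s hext using hX
  refine ⟨P, fun i => ι (i + 1) ∘ₗ π i, fun i => (s i).1, fun i p => ?_, fun Q hQ i f => ?_,
    ⟨e.trans ((LinearEquiv.ofInjective (ι 0) (s 0).2).trans (LinearEquiv.ofEq _ _ ?_))⟩⟩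
  · simp only [LinearMap.comp_apply, map_eq_zero_iff _ (s (i + 1 + 1)).2, (s (i + 1)).exact p]
    constructor
    · rintro ⟨x, rfl⟩
      obtain ⟨y, rfl⟩ := (s i).3 x
      exact ⟨y, rfl⟩
    · rintro ⟨y, rfl⟩
      exact ⟨_, rfl⟩
  · constructor
    · intro hf
      -- Since `π i` is onto, a cocycle `f` vanishes on the cycles `X (i + 1)`. It therefore
      -- descends to `X (i + 1 + 1)`, from where it extends.
      obtain ⟨f', hf'⟩ := exists_factor_surjective (π (i + 1)) (s (i + 1)).3 f (fun x hx => by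
        obtain ⟨y, rfl⟩ := ((s (i + 1)).exact x).1 hx
        obtain ⟨z, rfl⟩ := (s i).3 y
        exact LinearMap.congr_fun hf z)
      obtain ⟨h, hh⟩ := hext (i + 1 + 1) Q hQ f'
      exact ⟨h, LinearMap.ext fun x => by simp [hh, hf']⟩
    · rintro ⟨h, rfl⟩
      refine LinearMap.ext fun x => ?_
      have : π (i + 1) (ι (i + 1) (π i x)) = 0 := ((s (i + 1)).exact _).2 ⟨_, rfl⟩
      simp [this]
  · ext p
    rw [LinearMap.mem_ker, LinearMap.comp_apply, map_eq_zero_iff _ (s (0 + 1)).2, (s 0).exact p]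
    rfl

theorem IsGorensteinProjective.exists_family {M : ModuleCat.{u} R} (h : IsGorensteinProjective M) :
    ∃ X : ℤ → ModuleCat.{u} R, (∀ i, GorensteinStep (X i) (X (i + 1))) ∧
      Nonempty (M ≃ₗ[R] X 0) := by
  obtain ⟨P, d, hP, hd, hQ, e⟩ := h
  refine ⟨fun i => ModuleCat.of R (LinearMap.ker (d i)), fun i => ?_, e⟩
  -- Extending a map from the cycles in degree `i` uses exactness of `Hom` in degree `i - 1`, which
  -- involves the differential out of degree `i - 2`. The shift by two makes these indices agree
  -- definitionally.
  obtain ⟨k, rfl⟩ : ∃ k, i = k + 1 + 1 := ⟨i - 1 - 1, by ring⟩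
  have hdd : ∀ i x, d (i + 1) (d i x) = 0 := fun i x => (hd i _).2 ⟨x, rfl⟩
  have surj : ∀ i, Function.Surjective
      ((d i).codRestrict (LinearMap.ker (d (i + 1))) (fun x => hdd i x)) := by
    rintro i ⟨y, hy⟩
    obtain ⟨x, rfl⟩ := (hd i y).1 hy
    exact ⟨x, rfl⟩
  refine ⟨P (k + 1 + 1), (LinearMap.ker (d (k + 1 + 1))).subtype,
    (d (k + 1 + 1)).codRestrict (LinearMap.ker (d (k + 1 + 1 + 1))) (fun x => hdd _ x),
    ⟨hP _, Subtype.val_injective, surj _, fun p => ?_⟩, fun Q hQp g => ?_⟩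
  · constructor
    · intro hp
      exact ⟨⟨p, congrArg Subtype.val hp⟩, rfl⟩
    · rintro ⟨x, rfl⟩
      exact Subtype.ext x.2
  · obtain ⟨h, hh⟩ := (hQ Q hQp k
      (g ∘ₗ (d (k + 1)).codRestrict (LinearMap.ker (d (k + 1 + 1))) (fun x => hdd _ x))).1 (by
        refine LinearMap.ext fun x => ?_
        have : (d (k + 1)).codRestrict (LinearMap.ker (d (k + 1 + 1))) (fun x => hdd _ x) (d k x)
          = 0 := Subtype.ext (hdd k x)
        simp [this])
    refine ⟨h, fun x => ?_⟩
    obtain ⟨y, rfl⟩ := surj (k + 1) x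
    exact LinearMap.congr_fun hh y

theorem IsGorensteinProjective.of_equiv {M N : ModuleCat.{u} R} (h : IsGorensteinProjective M)
    (e : M ≃ₗ[R] N) : IsGorensteinProjective N := by
  obtain ⟨P, d, h1, h2, h3, ⟨e'⟩⟩ := h
  exact ⟨P, d, h1, h2, h3, ⟨e.symm.trans e'⟩⟩

theorem IsGorensteinProjective.exists_step_right {M : ModuleCat.{u} R}
    (h : IsGorensteinProjective M) :
    ∃ N : ModuleCat.{u} R, IsGorensteinProjective N ∧ GorensteinStep M N := by
  obtain ⟨X, hX, ⟨e⟩⟩ := h.exists_family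
  refine ⟨X (0 + 1), ?_, (hX 0).congr_left e⟩
  refine .of_family (fun i => X (i + 1)) (fun i => hX (i + 1)) _ (LinearEquiv.refl R _)

theorem IsGorensteinProjective.exists_step_left {M : ModuleCat.{u} R}
    (h : IsGorensteinProjective M) :
    ∃ N : ModuleCat.{u} R, IsGorensteinProjective N ∧ GorensteinStep N M := by
  obtain ⟨X, hX, ⟨e⟩⟩ := h.exists_family
  refine ⟨X (-1), ?_, (hX (-1)).congr_right e.symm⟩
  refine .of_family (fun i => X (i - 1)) (fun i => ?_) _ (LinearEquiv.refl R _)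
  have := hX (i - 1)
  rwa [show i - 1 + 1 = i + 1 - 1 by ring] at this

/-- The Gorenstein projective modules form the largest class of modules that is closed under taking
a suitable syzygy and a suitable cosyzygy. -/
theorem IsGorensteinProjective.of_class (C : ModuleCat.{u} R → Prop)
    (hr : ∀ X, C X → ∃ Y, C Y ∧ GorensteinStep X Y)
    (hl : ∀ X, C X → ∃ Y, C Y ∧ GorensteinStep Y X) {M : ModuleCat.{u} R} (hM : C M) :
    IsGorensteinProjective M := by
  choose r hrC hrs using hr
  choose l hlC hls using hl
  let F : ℕ → {X // C X} := fun n => Nat.rec ⟨M, hM⟩ (fun _ X => ⟨r X.1 X.2, hrC X.1 X.2⟩) n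
  let G : ℕ → {X // C X} := fun n => Nat.rec ⟨M, hM⟩ (fun _ X => ⟨l X.1 X.2, hlC X.1 X.2⟩) n
  -- Cosyzygies fill the nonnegative degrees and syzygies the negative ones. Both sequences start at
  -- `M`, so `G 0` is skipped.
  let X : ℤ → ModuleCat.{u} R := fun i => match i with
    | Int.ofNat n => (F n).1
    | Int.negSucc n => (G (n + 1)).1
  refine .of_family X (fun i => ?_) M (LinearEquiv.refl R M)
  match i with
  | Int.ofNat n => exact hrs (F n).1 (F n).2
  | Int.negSucc 0 => exact hls (G 0).1 (G 0).2
  | Int.negSucc (n + 1) => exact hls (G (n + 1)).1 (G (n + 1)).2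

/-- The steps are `0 → X → X → 0 → 0` and `0 → 0 → X → X → 0`. -/
theorem IsGorensteinProjective.of_projective (M : ModuleCat.{u} R) (hM : Module.Projective R M) :
    IsGorensteinProjective M := by
  refine .of_class (fun X => Module.Projective R X) (fun X hX => ?_) (fun X hX => ?_) hM
  · refine ⟨ModuleCat.of R PUnit, inferInstance, X, LinearMap.id, 0,
      ⟨hX, Function.injective_id, fun y => ⟨0, rfl⟩, fun x => ?_⟩, fun Q _ g => ⟨g, fun _ => rfl⟩⟩
    simp
  · refine ⟨ModuleCat.of R PUnit, inferInstance, X, 0, LinearMap.id,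
      ⟨hX, fun _ _ _ => rfl, Function.surjective_id, fun x => ?_⟩, fun Q _ g => ⟨0, fun x => ?_⟩⟩
    · simp [eq_comm]
    · rw [Subsingleton.elim x 0]; simp

/-- `K` is an extension of a Gorenstein projective module by another one. -/
def IsGorensteinExtension (K : ModuleCat.{u} R) : Prop :=
  ∃ (L H : ModuleCat.{u} R) (i : L →ₗ[R] K) (p : K →ₗ[R] H), IsGorensteinProjective L ∧
    IsGorensteinProjective H ∧ Function.Injective i ∧ Function.Surjective p ∧ Function.Exact i p

/-- A map to a projective module from the kernel of a surjection onto a Gorenstein projective module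
extends. -/
theorem IsGorensteinProjective.exists_extend {L K H : ModuleCat.{u} R}
    (hH : IsGorensteinProjective H) (i : L →ₗ[R] K) (p : K →ₗ[R] H) (hi : Function.Injective i)
    (hp : Function.Surjective p) (hip : Function.Exact i p) (Q : ModuleCat.{u} R)
    (hQ : Module.Projective R Q) (g : L →ₗ[R] Q) : ∃ h : K →ₗ[R] Q, ∀ x, h (i x) = g x := by
  obtain ⟨Z, -, P, ι, π, s, hext⟩ := hH.exists_step_left
  have := s.projective
  obtain ⟨t, ht⟩ := Module.projective_lifting_property p π hp
  replace ht : ∀ x, p (t x) = π x := fun x => LinearMap.congr_fun ht x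
  -- The extension `K` is the pushout of `ι` along `k`: the kernel of `L × P → K` consists of the
  -- pairs `(-k z, ι z)`. An extension `h` of `g ∘ k` to `P` therefore glues with `g` to a map on
  -- `K`.
  obtain ⟨k, hk⟩ := exists_factor_injective i hi (t ∘ₗ ι) (fun z => (hip _).1 (by
    rw [LinearMap.comp_apply, ht]; exact (s.exact _).2 ⟨z, rfl⟩))
  obtain ⟨h, hh⟩ := hext Q hQ (g ∘ₗ k)
  have hsurj : Function.Surjective (i.coprod t) := fun x => by
    obtain ⟨y, hy⟩ := s.surjective (p x)
    obtain ⟨l, hl⟩ := (hip (x - t y)).1 (by rw [map_sub, ht, hy, sub_self])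
    exact ⟨(l, y), by simp [hl]⟩
  obtain ⟨f, hf⟩ := exists_factor_surjective (i.coprod t) hsurj (g.coprod h) (by
    rintro ⟨l, y⟩ hly
    rw [LinearMap.coprod_apply] at hly
    have h0 : π y = 0 := by
      have := congrArg p hly
      rwa [map_add, (hip _).2 ⟨l, rfl⟩, zero_add, map_zero, ht] at this
    obtain ⟨z, rfl⟩ := (s.exact y).1 h0
    have : l + k z = 0 := hi (by rw [map_add, hk]; simpa using hly)
    rw [LinearMap.coprod_apply, hh, LinearMap.comp_apply, ← map_add, this, map_zero])
  exact ⟨f, fun x => by simpa using hf (x, 0)⟩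

/-- This is the horseshoe lemma on the cosyzygy side. Injectivity of `PL` is replaced by
`IsGorensteinProjective.exists_extend`, which extends the embedding of `L` into the projective `PL`
to all of `K`. -/
theorem IsGorensteinExtension.exists_step_right {K : ModuleCat.{u} R}
    (h : IsGorensteinExtension K) :
    ∃ K' : ModuleCat.{u} R, IsGorensteinExtension K' ∧ GorensteinStep K K' := by
  obtain ⟨L, H, i, p, hL, hH, hi, hp, hip⟩ := h
  obtain ⟨L', hL', PL, ιL, πL, sL, eL⟩ := hL.exists_step_right
  obtain ⟨H', hH', PH, ιH, πH, sH, eH⟩ := hH.exists_step_right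
  obtain ⟨e, he⟩ := hH.exists_extend i p hi hp hip PL sL.projective ιL
  let j : K →ₗ[R] PL × PH := e.prod (ιH ∘ₗ p)
  have hpi : ∀ x, p (i x) = 0 := fun x => (hip _).2 ⟨x, rfl⟩
  have hπιL : ∀ x, πL (ιL x) = 0 := fun x => (sL.exact _).2 ⟨x, rfl⟩
  have hπιH : ∀ x, πH (ιH x) = 0 := fun x => (sH.exact _).2 ⟨x, rfl⟩
  have hj : Function.Injective j := by
    refine (injective_iff_map_eq_zero j).2 fun x hx => ?_
    have h1 : e x = 0 := congrArg Prod.fst hx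
    have h2 : ιH (p x) = 0 := congrArg Prod.snd hx
    obtain ⟨l, rfl⟩ := (hip x).1 ((map_eq_zero_iff _ sH.injective).1 h2)
    rw [he, map_eq_zero_iff _ sL.injective] at h1
    rw [h1, map_zero]
  let q := (LinearMap.range j).mkQ
  have hq : Function.Surjective q := Submodule.mkQ_surjective _
  have hqj : ∀ x, q x = 0 ↔ ∃ y, j y = x := fun x => by
    simp [q]
  have := sL.projective
  have := sH.projective
  obtain ⟨a, ha⟩ := exists_factor_surjective πL sL.surjective (q ∘ₗ LinearMap.inl R PL PH)
    (fun x hx => by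
      obtain ⟨l, rfl⟩ := (sL.exact x).1 hx
      exact (hqj _).2 ⟨i l, Prod.ext (he l) (by simp [j, hpi])⟩)
  obtain ⟨b, hb⟩ := exists_factor_surjective q hq (πH ∘ₗ LinearMap.snd R PL PH) (fun x hx => by
    obtain ⟨y, rfl⟩ := (hqj x).1 hx
    exact hπιH _)
  refine ⟨ModuleCat.of R ((PL × PH) ⧸ LinearMap.range j),
    ⟨L', H', a, b, hL', hH', ?_, ?_, fun x => ⟨fun hx => ?_, ?_⟩⟩,
    ModuleCat.of R (PL × PH), j, q,
    ⟨inferInstanceAs (Module.Projective R (PL × PH)), hj, hq, fun x => hqj x⟩,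
    fun Q hQ g => ?_⟩
  · refine (injective_iff_map_eq_zero a).2 fun x hx => ?_
    obtain ⟨y, rfl⟩ := sL.surjective x
    rw [ha] at hx
    obtain ⟨k, hk⟩ := (hqj _).1 hx
    have h2 : ιH (p k) = 0 := congrArg Prod.snd hk
    have h1 : e k = y := congrArg Prod.fst hk
    obtain ⟨l, rfl⟩ := (hip k).1 ((map_eq_zero_iff _ sH.injective).1 h2)
    rw [← h1, he, hπιL]
  · intro y
    obtain ⟨x, rfl⟩ := sH.surjective y
    exact ⟨q (0, x), hb _⟩
  · obtain ⟨⟨y, z⟩, rfl⟩ := hq x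
    rw [hb] at hx
    obtain ⟨w, hw⟩ := (sH.exact z).1 hx
    obtain ⟨k, rfl⟩ := hp w
    refine ⟨πL (y - e k), ?_⟩
    rw [ha, ← sub_eq_zero, LinearMap.comp_apply, ← map_sub]
    exact (hqj _).2 ⟨-k, by ext <;> simp [j, ← hw]⟩
  · rintro ⟨y, rfl⟩
    obtain ⟨z, rfl⟩ := sL.surjective y
    rw [ha, LinearMap.comp_apply, hb]
    simp
  -- First extend `g` restricted to `L` over `PL`; the difference `g - g1 ∘ e` vanishes on `L`, so
  -- it comes from `H` and extends over `PH`.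
  · obtain ⟨g1, hg1⟩ := eL Q hQ (g ∘ₗ i)
    obtain ⟨g2, hg2⟩ := exists_factor_surjective p hp (g - g1 ∘ₗ e) (fun x hx => by
      obtain ⟨l, rfl⟩ := (hip x).1 hx
      simp [he, hg1])
    obtain ⟨g3, hg3⟩ := eH Q hQ g2
    exact ⟨g1.coprod g3, fun x => by simp [j, hg3, hg2]⟩

/-- The horseshoe lemma for the first syzygies. -/
theorem exists_horseshoe {L K H XL PH L' H' : Type u} [AddCommGroup L] [Module R L]
    [AddCommGroup K] [Module R K] [AddCommGroup H] [Module R H] [AddCommGroup XL] [Module R XL]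
    [AddCommGroup PH] [Module R PH] [AddCommGroup L'] [Module R L'] [AddCommGroup H'] [Module R H']
    (i : L →ₗ[R] K) (p : K →ₗ[R] H) (hi : Function.Injective i) (hp : Function.Surjective p)
    (hip : Function.Exact i p) (ιL : L' →ₗ[R] XL) (πL : XL →ₗ[R] L) (hιL : Function.Injective ιL)
    (hπL : Function.Surjective πL) (hL : Function.Exact ιL πL) (ιH : H' →ₗ[R] PH) (πH : PH →ₗ[R] H)
    (s : ProjectiveStep H' PH H ιH πH) :
    ∃ (f : XL × PH →ₗ[R] K) (i' : L' →ₗ[R] LinearMap.ker f) (p' : LinearMap.ker f →ₗ[R] H'),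
      Function.Surjective f ∧ Function.Injective i' ∧ Function.Surjective p' ∧
      Function.Exact i' p' ∧ ∀ l, (i' l : XL × PH) = (ιL l, 0) ∧
        ∀ x : LinearMap.ker f, ιH (p' x) = (x : XL × PH).2 := by
  have := s.projective
  obtain ⟨t, ht⟩ := Module.projective_lifting_property p πH hp
  replace ht : ∀ x, p (t x) = πH x := fun x => LinearMap.congr_fun ht x
  have hpi : ∀ x, p (i x) = 0 := fun x => (hip _).2 ⟨x, rfl⟩
  have hπι : ∀ x, πL (ιL x) = 0 := fun x => (hL _).2 ⟨x, rfl⟩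
  -- Only `PH` has to be projective, for the lift `t`. Leaving `XL` arbitrary lets the construction
  -- also serve resolutions by Gorenstein projectives.
  let f : XL × PH →ₗ[R] K := (i ∘ₗ πL).coprod t
  have hf : ∀ x y, f (x, y) = i (πL x) + t y := fun x y => by simp [f]
  have hfker : ∀ x : LinearMap.ker f, πH (x : XL × PH).2 = 0 := by
    rintro ⟨⟨x, y⟩, hxy⟩
    rw [LinearMap.mem_ker, hf] at hxy
    have := congrArg p hxy
    simpa [hpi, ht] using this
  obtain ⟨p', hp'⟩ := exists_factor_injective ιH s.injective
    (LinearMap.snd R XL PH ∘ₗ (LinearMap.ker f).subtype) (fun x => (s.exact _).1 (hfker x))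
  let i' : L' →ₗ[R] LinearMap.ker f := (LinearMap.inl R XL PH ∘ₗ ιL).codRestrict _ (fun l => by
    rw [LinearMap.mem_ker, LinearMap.comp_apply, LinearMap.inl_apply, hf, hπι]; simp)
  refine ⟨f, i', p', fun x => ?_, fun x y hxy => ?_, fun z => ?_, fun x => ⟨fun hx => ?_, ?_⟩,
    fun l => ⟨rfl, hp'⟩⟩
  · obtain ⟨y, hy⟩ := s.surjective (p x)
    obtain ⟨l, hl⟩ := (hip (x - t y)).1 (by rw [map_sub, ht, hy, sub_self])
    obtain ⟨w, rfl⟩ := hπL l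
    exact ⟨(w, y), by rw [hf, hl, sub_add_cancel]⟩
  · exact hιL (congrArg (fun z : LinearMap.ker f => (z : XL × PH).1) hxy)
  · obtain ⟨l, hl⟩ := (hip (t (ιH z))).1 (by rw [ht]; exact (s.exact _).2 ⟨z, rfl⟩)
    obtain ⟨w, rfl⟩ := hπL l
    refine ⟨⟨(-w, ιH z), ?_⟩, s.injective (hp' _)⟩
    rw [LinearMap.mem_ker, hf, map_neg, map_neg, hl, neg_add_cancel]
  · have h2 : (x : XL × PH).2 = 0 := by
      have := hp' x
      rw [hx, map_zero] at this
      exact this.symm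
    obtain ⟨⟨a, b⟩, hab⟩ := x
    obtain rfl : b = 0 := h2
    rw [LinearMap.mem_ker, hf, map_zero, add_zero, map_eq_zero_iff _ hi] at hab
    obtain ⟨l, rfl⟩ := (hL a).1 hab
    exact ⟨l, rfl⟩
  · rintro ⟨l, rfl⟩
    exact s.injective (by rw [hp', map_zero]; rfl)

theorem IsGorensteinExtension.exists_step_left {K : ModuleCat.{u} R}
    (h : IsGorensteinExtension K) :
    ∃ K' : ModuleCat.{u} R, IsGorensteinExtension K' ∧ GorensteinStep K' K := by
  obtain ⟨L, H, i, p, hL, hH, hi, hp, hip⟩ := h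
  obtain ⟨L', hL', PL, ιL, πL, sL, eL⟩ := hL.exists_step_left
  obtain ⟨H', hH', PH, ιH, πH, sH, eH⟩ := hH.exists_step_left
  obtain ⟨f, i', p', hf, hi', hp', hip', hc⟩ := exists_horseshoe i p hi hp hip ιL πL sL.injective
    sL.surjective sL.exact ιH πH sH
  have := sL.projective
  have := sH.projective
  refine ⟨ModuleCat.of R (LinearMap.ker f), ⟨L', H', i', p', hL', hH', hi', hp', hip'⟩,
    ModuleCat.of R (PL × PH), (LinearMap.ker f).subtype, f,
    ⟨inferInstanceAs (Module.Projective R (PL × PH)), Subtype.val_injective, hf, fun x => ?_⟩,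
    fun Q hQ g => ?_⟩
  · exact ⟨fun hx => ⟨⟨x, hx⟩, rfl⟩, fun ⟨y, hy⟩ => hy ▸ y.2⟩
  · obtain ⟨g1, hg1⟩ := eL Q hQ (g ∘ₗ i')
    obtain ⟨g2, hg2⟩ := exists_factor_surjective p' hp'
      (g - g1 ∘ₗ LinearMap.fst R PL PH ∘ₗ (LinearMap.ker f).subtype) (fun x hx => by
      obtain ⟨l, rfl⟩ := (hip' x).1 hx
      have := (hc l).1
      simp [this, hg1])
    obtain ⟨g3, hg3⟩ := eH Q hQ g2
    refine ⟨g1.coprod g3, fun x => ?_⟩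
    -- The identity for `p'` sits under the quantifier over `l` without depending on it, so any
    -- value, here `0`, gives access to it.
    have h1 : ιH (p' x) = (x : PL × PH).2 := (hc 0).2 x
    change g1 (x : PL × PH).1 + g3 (x : PL × PH).2 = g x
    rw [← h1, hg3, hg2]
    simp

/-- Syzygies and cosyzygies of extensions are again extensions, so the coinductive principle
`of_class` applies. -/
theorem IsGorensteinExtension.isGorensteinProjective {K : ModuleCat.{u} R}
    (h : IsGorensteinExtension K) : IsGorensteinProjective K :=
  .of_class IsGorensteinExtension (fun _ => exists_step_right) (fun _ => exists_step_left) h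

theorem IsGorensteinProjective.prod {X Y : ModuleCat.{u} R} (hX : IsGorensteinProjective X)
    (hY : IsGorensteinProjective Y) : IsGorensteinProjective (ModuleCat.of R (X × Y)) :=
  IsGorensteinExtension.isGorensteinProjective ⟨X, Y, LinearMap.inl R X Y, LinearMap.snd R X Y,
    hX, hY, LinearMap.inl_injective, LinearMap.snd_surjective, .inl_snd⟩

/-! ### Resolutions -/

theorem HasResolution.of_equiv {C : ModuleCat.{u} R → Prop}
    (hC : ∀ X Y : ModuleCat.{u} R, (X ≃ₗ[R] Y) → C X → C Y) (n : ℕ) {M N : ModuleCat.{u} R}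
    (e : M ≃ₗ[R] N) (h : HasResolution C n M) : HasResolution C n N := by
  cases n with
  | zero => exact hC _ _ e h
  | succ n =>
    obtain ⟨X, f, hX, hf, hk⟩ := h
    refine ⟨X, e.toLinearMap ∘ₗ f, hX, e.surjective.comp hf, ?_⟩
    rwa [LinearEquiv.ker_comp]

/-- A resolution is padded by a zero module at its far end. -/
theorem HasResolution.succ {C : ModuleCat.{u} R → Prop}
    (hC : ∀ X : ModuleCat.{u} R, Subsingleton X → C X) (n : ℕ) :
    ∀ {M : ModuleCat.{u} R}, HasResolution C n M → HasResolution C (n + 1) M := by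
  induction n with
  | zero =>
    refine fun {M} h => ⟨M, LinearMap.id, h, Function.surjective_id, hC _ ?_⟩
    simp only [LinearMap.ker_id]
    infer_instance
  | succ n ih =>
    rintro M ⟨X, f, hX, hf, hk⟩
    exact ⟨X, f, hX, hf, ih hk⟩

theorem HasResolution.mono {C : ModuleCat.{u} R → Prop}
    (hC : ∀ X : ModuleCat.{u} R, Subsingleton X → C X) {m n : ℕ} (hmn : m ≤ n)
    {M : ModuleCat.{u} R} (h : HasResolution C m M) : HasResolution C n M := by
  induction hmn with
  | refl => exact h
  | step _ ih => exact ih.succ hC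

theorem exists_hasResolution_of_lt_top {C : ModuleCat.{u} R → Prop} {M : ModuleCat.{u} R}
    (h : resolutionDim C M < ⊤) : ∃ n, HasResolution C n M := by
  by_contra! hn
  refine h.ne ?_
  simp [resolutionDim, hn]

theorem resolutionDim_le_iff {C : ModuleCat.{u} R → Prop}
    (hC : ∀ X : ModuleCat.{u} R, Subsingleton X → C X) {M : ModuleCat.{u} R} {n : ℕ} :
    resolutionDim C M ≤ n ↔ HasResolution C n M := by
  refine ⟨fun h => ?_, fun h => iInf₂_le n h⟩
  -- A strict inequality is needed to extract a witness from the infimum; `m < n + 1` then gives `m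
  -- ≤ n`.
  have h1 : resolutionDim C M < (n + 1 : ℕ) := lt_of_le_of_lt h (by exact_mod_cast n.lt_succ_self)
  simp only [resolutionDim, iInf_lt_iff] at h1
  obtain ⟨m, hm, hmn⟩ := h1
  exact hm.mono hC (Nat.lt_succ_iff.1 (by exact_mod_cast hmn))

theorem IsGorensteinProjective.of_subsingleton (X : ModuleCat.{u} R) (_ : Subsingleton X) :
    IsGorensteinProjective X :=
  have := Module.Free.of_subsingleton R X
  .of_projective X .of_free

/-- An extension of a Gorenstein projective module by `L` has Gorenstein projective resolutions of
the lengths that `L` has. -/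
theorem HasResolution.extension (n : ℕ) : ∀ {L K H : ModuleCat.{u} R} (i : L →ₗ[R] K)
    (p : K →ₗ[R] H), Function.Injective i → Function.Surjective p → Function.Exact i p →
    IsGorensteinProjective H → HasResolution IsGorensteinProjective n L →
    HasResolution IsGorensteinProjective n K := by
  induction n with
  | zero =>
    intro L K H i p hi hp hip hH hL
    exact IsGorensteinExtension.isGorensteinProjective ⟨L, H, i, p, hL, hH, hi, hp, hip⟩
  | succ n ih =>
    rintro L K H i p hi hp hip hH ⟨X, πL, hX, hπL, hk⟩
    obtain ⟨H', hH', PH, ιH, πH, sH, -⟩ := hH.exists_step_left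
    obtain ⟨f, i', p', hf, hi', hp', hip', -⟩ := exists_horseshoe i p hi hp hip
      (LinearMap.ker πL).subtype πL Subtype.val_injective hπL
      (fun x => ⟨fun hx => ⟨⟨x, hx⟩, rfl⟩, fun ⟨y, hy⟩ => hy ▸ y.2⟩) ιH πH sH
    exact ⟨ModuleCat.of R (X × PH), f, hX.prod (.of_projective PH sH.projective), hf,
      ih (L := ModuleCat.of R (LinearMap.ker πL)) (K := ModuleCat.of R (LinearMap.ker f))
        i' p' hi' hp' hip' hH' hk⟩

end GorensteinProjective

/-! ### Total acyclicity over Gorenstein regular rings -/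

section GorensteinRegular

variable {R : Type u} [Ring R]

/-- Dimension shifting along an embedding into an injective module. The strict bounds mean that `Q`
has injective dimension at most `n + 1` and `Q'` at most `n`. -/
theorem exists_injective_cosyzygy (n : ℕ) (Q : ModuleCat.{u} R)
    (hQ : HasInjectiveDimensionLT Q (n + 2)) :
    ∃ (I Q' : ModuleCat.{u} R) (f : Q →ₗ[R] I) (q : I →ₗ[R] Q'), Module.Injective R I ∧
      Function.Injective f ∧ Function.Surjective q ∧ Function.Exact f q ∧
      HasInjectiveDimensionLT Q' (n + 1) := by
  obtain ⟨⟨I, hI, f, hf⟩⟩ := EnoughInjectives.presentation Q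
  let S := ShortComplex.mk f (Limits.cokernel.π f) (by simp)
  have hS : S.ShortExact := { exact := ShortComplex.exact_cokernel f }
  exact ⟨I, Limits.cokernel f, f.hom, (Limits.cokernel.π f).hom,
    (Module.injective_iff_injective_object R I).2 hI, hS.moduleCat_injective_f,
    hS.moduleCat_surjective_g,
    (ShortComplex.ShortExact.moduleCat_exact_iff_function_exact S).1 hS.exact,
    (hS.hasInjectiveDimensionLT_X₃_iff n hI).2 hQ⟩

/-- In an exact complex of projectives, maps from the cycles to a module of finite injective
dimension extend. -/
theorem exists_extend_of_hasInjectiveDimensionLT {X P : ℤ → ModuleCat.{u} R}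
    {ι : ∀ i, X i →ₗ[R] P i} {π : ∀ i, P i →ₗ[R] X (i + 1)}
    (s : ∀ i, ProjectiveStep (X i) (P i) (X (i + 1)) (ι i) (π i)) (n : ℕ) :
    ∀ Q : ModuleCat.{u} R, HasInjectiveDimensionLT Q (n + 1) → ∀ i (g : X i →ₗ[R] Q),
      ∃ h : P i →ₗ[R] Q, ∀ x, h (ι i x) = g x := by
  induction n with
  | zero =>
    intro Q hQ i g
    have h1 : Injective Q := injective_iff_hasInjectiveDimensionLT_one.2 hQ
    have h2 := (Module.injective_iff_injective_object R Q).2 h1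
    exact h2.out (ι i) (s i).injective g
  | succ n ih =>
    intro Q hQ i g
    obtain ⟨I, Q', f, q, hI, hf, hq, hfq, hQ'⟩ := exists_injective_cosyzygy n Q hQ
    have hπι : ∀ x, π i (ι i x) = 0 := fun x => ((s i).exact _).2 ⟨x, rfl⟩
    -- The extension `h` lands in `I` rather than `Q`. Its obstruction `q ∘ h` descends to `X (i +
    -- 1)`, extends to `P (i + 1)` by induction and lifts to `k` with values in `I`. Subtracting
    -- this correction, which vanishes on `X i`, moves `h` into `Q`.
    obtain ⟨h, hh⟩ := hI.out (ι i) (s i).injective (f ∘ₗ g)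
    obtain ⟨h₁, hh₁⟩ := exists_factor_surjective (π i) (s i).surjective (q ∘ₗ h) (fun x hx => by
      obtain ⟨y, rfl⟩ := ((s i).exact x).1 hx
      rw [LinearMap.comp_apply, hh]
      exact (hfq _).2 ⟨g y, rfl⟩)
    obtain ⟨h₂, hh₂⟩ := ih Q' hQ' (i + 1) h₁
    have := (s (i + 1)).projective
    obtain ⟨k, hk⟩ := Module.projective_lifting_property q h₂ hq
    obtain ⟨l, hl⟩ := exists_factor_injective f hf (h - k ∘ₗ ι (i + 1) ∘ₗ π i) (fun x => by
      refine (hfq _).1 ?_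
      have := LinearMap.congr_fun hk (ι (i + 1) (π i x))
      rw [LinearMap.comp_apply] at this
      simp [this, hh₂, hh₁])
    exact ⟨l, fun x => hf (by simp [hl, hh, hπι])⟩

/-- Projectives have finite projective dimension, hence finite injective dimension. The bound may
depend on `Q`, because extension of maps is tested one `Q` at a time. -/
theorem IsLeftGorensteinRegular.exists_hasInjectiveDimensionLT (hR : IsLeftGorensteinRegular R)
    (Q : ModuleCat.{u} R) (hQ : Module.Projective R Q) :
    ∃ n : ℕ, HasInjectiveDimensionLT Q (n + 1) := by
  have hQ' : Projective Q := (IsProjective.iff_projective Q).1 hQ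
  exact (injectiveDimension_ne_top_iff Q).1 ((hR.finite_iff Q).1
    ((projectiveDimension_ne_top_iff Q).2 ⟨0, inferInstance⟩))

/-- Over a Gorenstein regular ring, the cycles of an exact complex of projectives are Gorenstein
projective. -/
theorem IsLeftGorensteinRegular.isGorensteinProjective (hR : IsLeftGorensteinRegular R)
    {X P : ℤ → ModuleCat.{u} R} {ι : ∀ i, X i →ₗ[R] P i} {π : ∀ i, P i →ₗ[R] X (i + 1)}
    (s : ∀ i, ProjectiveStep (X i) (P i) (X (i + 1)) (ι i) (π i)) :
    IsGorensteinProjective (X 0) := by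
  refine .of_family X (fun i => ⟨P i, ι i, π i, s i, fun Q hQ g => ?_⟩) _ (LinearEquiv.refl R _)
  obtain ⟨n, hn⟩ := hR.exists_hasInjectiveDimensionLT Q hQ
  exact exists_extend_of_hasInjectiveDimensionLT s n Q hn i g

end GorensteinRegular

/-! ### Exactness of the tensor product -/

section TensorLemmas

variable {A : Type u} [Ring A] {U V W : Type u} [AddCommGroup U] [Module Aᵐᵒᵖ U]
  [AddCommGroup V] [Module Aᵐᵒᵖ V] [AddCommGroup W] [Module Aᵐᵒᵖ W]
  {M N L : Type u} [AddCommGroup M] [Module A M] [AddCommGroup N] [Module A N]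
  [AddCommGroup L] [Module A L]

/-- The additive map on `U ⊗_A M` induced by a balanced biadditive map. -/
def Tens.lift {G : Type*} [AddCommGroup G] (f : U →+ M →+ G)
    (hf : ∀ u (a : A) m, f (op a • u) m = f u (a • m)) : Tens A U M →+ G :=
  QuotientAddGroup.lift (balancedRel A U M) (TensorProduct.liftAddHom f (fun n u m => by simp)) (by
    refine (AddSubgroup.closure_le _).2 ?_
    rintro _ ⟨u, a, m, rfl⟩
    simp [hf])

theorem Tens.addHom_ext {G : Type*} [AddCommGroup G] {f g : Tens A U M →+ G}
    (h : ∀ u m, f (tmul A u m) = g (tmul A u m)) : f = g := by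
  ext x
  induction x using Tens.induction with
  | h0 => simp
  | ht u m => exact h u m
  | ha x y hx hy => simp [hx, hy]

theorem Tens.map_map (g : U →ₗ[Aᵐᵒᵖ] V) (g' : V →ₗ[Aᵐᵒᵖ] W) (f : M →ₗ[A] N) (f' : N →ₗ[A] L)
    (x : Tens A U M) : Tens.map g' f' (Tens.map g f x) = Tens.map (g' ∘ₗ g) (f' ∘ₗ f) x :=
  DFunLike.congr_fun (Tens.addHom_ext (f := (Tens.map g' f').comp (Tens.map g f))
    (g := Tens.map (g' ∘ₗ g) (f' ∘ₗ f)) fun _ _ => rfl) x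

theorem Tens.map_id (x : Tens A U M) :
    Tens.map (LinearMap.id : U →ₗ[Aᵐᵒᵖ] U) (LinearMap.id : M →ₗ[A] M) x = x :=
  DFunLike.congr_fun (Tens.addHom_ext (f := Tens.map (LinearMap.id : U →ₗ[Aᵐᵒᵖ] U)
    (LinearMap.id : M →ₗ[A] M)) (g := AddMonoidHom.id _) fun _ _ => rfl) x

theorem Tens.map_zero_right (g : U →ₗ[Aᵐᵒᵖ] V) (x : Tens A U M) :
    Tens.map g (0 : M →ₗ[A] N) x = 0 :=
  DFunLike.congr_fun (Tens.addHom_ext (f := Tens.map g (0 : M →ₗ[A] N)) (g := 0)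
    fun u _ => tmul_zero (g u)) x

theorem Tens.map_zero_left (f : M →ₗ[A] N) (x : Tens A U M) :
    Tens.map (0 : U →ₗ[Aᵐᵒᵖ] V) f x = 0 :=
  DFunLike.congr_fun (Tens.addHom_ext (f := Tens.map (0 : U →ₗ[Aᵐᵒᵖ] V) f) (g := 0)
    fun _ m => zero_tmul (f m)) x

theorem Tens.map_surjective {g : U →ₗ[Aᵐᵒᵖ] V} {f : M →ₗ[A] N} (hg : Function.Surjective g)
    (hf : Function.Surjective f) : Function.Surjective (Tens.map g f) := fun x => by
  induction x using Tens.induction with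
  | h0 => exact ⟨0, map_zero _⟩
  | ht v n =>
    obtain ⟨u, rfl⟩ := hg v
    obtain ⟨m, rfl⟩ := hf n
    exact ⟨tmul A u m, rfl⟩
  | ha x y hx hy =>
    obtain ⟨a, rfl⟩ := hx
    obtain ⟨b, rfl⟩ := hy
    exact ⟨a + b, map_add _ _ _⟩

/-- `U ⊗_A -` is right exact. -/
theorem Tens.exact_right {f : L →ₗ[A] M} {g : M →ₗ[A] N} (hg : Function.Surjective g)
    (h : Function.Exact f g) (U : Type u) [AddCommGroup U] [Module Aᵐᵒᵖ U] :
    Function.Exact (Tens.map (LinearMap.id : U →ₗ[Aᵐᵒᵖ] U) f) (Tens.map LinearMap.id g) := by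
  let S := (Tens.map (LinearMap.id : U →ₗ[Aᵐᵒᵖ] U) f).range
  have key : ∀ (u : U) (m m' : M), g m = g m' →
      (tmul A u m : Tens A U M ⧸ S) = (tmul A u m' : Tens A U M ⧸ S) := by
    intro u m m' hm
    obtain ⟨l, hl⟩ := (h (m - m')).1 (by rw [map_sub, hm, sub_self])
    rw [QuotientAddGroup.eq_iff_sub_mem]
    refine ⟨tmul A u l, ?_⟩
    rw [Tens.map_tmul, hl, sub_eq_add_neg, tmul_add, sub_eq_add_neg]
    congr 1
    rw [eq_neg_iff_add_eq_zero, LinearMap.id_apply, ← tmul_add, neg_add_cancel, tmul_zero]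
  -- The set-theoretic section `r` is not additive, but `key` makes its choices irrelevant modulo
  -- `S`. The resulting map from `U ⊗ N` to the cokernel shows that the kernel lies in `S`.
  let r : N → M := Function.surjInv hg
  have hr : ∀ n, g (r n) = n := Function.surjInv_eq hg
  let φ : Tens A U N →+ Tens A U M ⧸ S := Tens.lift
    { toFun := fun u =>
        { toFun := fun n => (tmul A u (r n) : Tens A U M ⧸ S)
          map_zero' := by
            rw [key u (r 0) 0 (by simp [hr]), tmul_zero]; rfl
          map_add' := fun n n' => by
            rw [key u (r (n + n')) (r n + r n') (by simp [hr]), tmul_add]; rfl }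
      map_zero' := by ext n; simp [zero_tmul]
      map_add' := fun u u' => by ext n; simp [add_tmul] }
    (fun u a n => by
      change (tmul A (op a • u) (r n) : Tens A U M ⧸ S) = (tmul A u (r (a • n)) : Tens A U M ⧸ S)
      rw [op_smul_tmul]
      exact key _ _ _ (by simp [hr]))
  have hφ : φ.comp (Tens.map LinearMap.id g) = QuotientAddGroup.mk' S :=
    Tens.addHom_ext fun u m => key _ _ _ (hr _)
  refine fun x => ⟨fun hx => ?_, ?_⟩
  · have := DFunLike.congr_fun hφ x
    rw [AddMonoidHom.comp_apply, hx, map_zero] at this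
    exact (QuotientAddGroup.eq_zero_iff x).1 this.symm
  · rintro ⟨y, rfl⟩
    rw [Tens.map_map, show g ∘ₗ f = 0 from LinearMap.ext fun z => (h _).2 ⟨z, rfl⟩]
    exact Tens.map_zero_right _ y

/-- `- ⊗_A M` is right exact. -/
theorem Tens.exact_left {f : U →ₗ[Aᵐᵒᵖ] V} {g : V →ₗ[Aᵐᵒᵖ] W} (hg : Function.Surjective g)
    (h : Function.Exact f g) (M : Type u) [AddCommGroup M] [Module A M] :
    Function.Exact (Tens.map f (LinearMap.id : M →ₗ[A] M)) (Tens.map g LinearMap.id) := by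
  let S := (Tens.map f (LinearMap.id : M →ₗ[A] M)).range
  have key : ∀ (v v' : V) (m : M), g v = g v' →
      (tmul A v m : Tens A V M ⧸ S) = (tmul A v' m : Tens A V M ⧸ S) := by
    intro v v' m hm
    obtain ⟨l, hl⟩ := (h (v - v')).1 (by rw [map_sub, hm, sub_self])
    rw [QuotientAddGroup.eq_iff_sub_mem]
    refine ⟨tmul A l m, ?_⟩
    rw [Tens.map_tmul, hl, sub_eq_add_neg, add_tmul, sub_eq_add_neg]
    congr 1
  let r : W → V := Function.surjInv hg
  have hr : ∀ n, g (r n) = n := Function.surjInv_eq hg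
  let φ : Tens A W M →+ Tens A V M ⧸ S := Tens.lift
    { toFun := fun w =>
        { toFun := fun m => (tmul A (r w) m : Tens A V M ⧸ S)
          map_zero' := by rw [tmul_zero]; rfl
          map_add' := fun m m' => by rw [tmul_add]; rfl }
      map_zero' := by
        ext m
        exact (key (r 0) 0 m (by simp [hr])).trans (by rw [zero_tmul]; rfl)
      map_add' := fun w w' => by
        ext m
        exact (key (r (w + w')) (r w + r w') m (by simp [hr])).trans (by rw [add_tmul]; rfl) }
    (fun w a m => by
      change (tmul A (r (op a • w)) m : Tens A V M ⧸ S) = (tmul A (r w) (a • m) : Tens A V M ⧸ S)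
      rw [← op_smul_tmul]
      exact key _ _ _ (by simp [hr]))
  have hφ : φ.comp (Tens.map g LinearMap.id) = QuotientAddGroup.mk' S :=
    Tens.addHom_ext fun u m => key _ _ _ (hr _)
  refine fun x => ⟨fun hx => ?_, ?_⟩
  · have := DFunLike.congr_fun hφ x
    rw [AddMonoidHom.comp_apply, hx, map_zero] at this
    exact (QuotientAddGroup.eq_zero_iff x).1 this.symm
  · rintro ⟨y, rfl⟩
    rw [Tens.map_map, show g ∘ₗ f = 0 from LinearMap.ext fun z => (h _).2 ⟨z, rfl⟩]
    exact Tens.map_zero_left _ y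

/-! ### Tensor products with a projective module -/

/-- The map `V ⊗_A P → V^(P)` sending `v ⊗ p` to the coordinates of `p` acting on `v`, where the
coordinates are given by a map `s : P → A^(P)`. -/
noncomputable def Tens.coords (s : M →ₗ[A] (M →₀ A))
    (V : Type u) [AddCommGroup V] [Module Aᵐᵒᵖ V] :
    Tens A V M →+ (M →₀ V) :=
  Tens.lift
    { toFun := fun v =>
        { toFun := fun m => (s m).mapRange (fun a => op a • v) (by simp)
          map_zero' := by ext; simp
          map_add' := fun m m' => by ext; simp [add_smul] }
      map_zero' := by ext; simp
      map_add' := fun v v' => by ext; simp }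
    (fun v a m => by ext; simp [mul_smul])

theorem Tens.coords_tmul (s : M →ₗ[A] (M →₀ A)) (v : V) (m m' : M) :
    Tens.coords s V (tmul A v m) m' = op (s m m') • v := rfl

/-- The map `V^(P) → V ⊗_A P` with `v` at `p` going to `v ⊗ p`. -/
noncomputable def Tens.ofCoords (A : Type u) [Ring A]
    (V M : Type u) [AddCommGroup V] [Module Aᵐᵒᵖ V]
    [AddCommGroup M] [Module A M] : (M →₀ V) →+ Tens A V M :=
  Finsupp.liftAddHom fun m => { toFun := fun v => tmul A v m
                                map_zero' := zero_tmul m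
                                map_add' := fun v v' => add_tmul v v' m }

theorem Tens.ofCoords_single (v : V) (m : M) :
    Tens.ofCoords A V M (Finsupp.single m v) = tmul A v m := by
  simp only [Tens.ofCoords, Finsupp.liftAddHom_apply_single]
  rfl

/-- This is the dual basis argument: a section of `A^(M) → M` makes `V ⊗ M` a retract of `V^(M)`,
naturally in `V`. -/
theorem Tens.ofCoords_coords (s : M →ₗ[A] (M →₀ A))
    (hs : ∀ m, Finsupp.linearCombination A id (s m) = m) (x : Tens A V M) :
    Tens.ofCoords A V M (Tens.coords s V x) = x := by
  refine DFunLike.congr_fun (Tens.addHom_ext (f := (Tens.ofCoords A V M).comp (Tens.coords s V))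
    (g := AddMonoidHom.id _) fun v m => ?_) x
  change Tens.ofCoords A V M ((s m).mapRange (fun a => op a • v) (by simp)) = tmul A v m
  conv_rhs => rw [← hs m]
  generalize s m = t
  induction t using Finsupp.induction_linear with
  | zero => simp [tmul_zero]
  | add t t' ht ht' =>
    rw [map_add, tmul_add, ← ht, ← ht', ← map_add]
    congr 1
    ext
    simp [add_smul]
  | single p a =>
    rw [Finsupp.mapRange_single, Tens.ofCoords_single, op_smul_tmul]
    simp

theorem Tens.map_injective_of_projective (hM : Module.Projective A M) (g : U →ₗ[Aᵐᵒᵖ] V)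
    (hg : Function.Injective g) :
    Function.Injective (Tens.map g (LinearMap.id : M →ₗ[A] M)) := by
  obtain ⟨s, hs⟩ := hM.out
  refine (injective_iff_map_eq_zero _).2 fun x hx => ?_
  have h : ∀ m, g (Tens.coords s U x m) = Tens.coords s V (Tens.map g LinearMap.id x) m := by
    intro m
    clear hx
    induction x using Tens.induction with
    | h0 => simp
    | ht u m => simp [Tens.map_tmul, Tens.coords_tmul]
    | ha x y hx hy => simp [hx, hy]
  rw [← Tens.ofCoords_coords s hs x, show Tens.coords s U x = 0 from Finsupp.ext fun m => hg (by
    rw [h, hx]; simp), map_zero]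

section Bimodule

variable {B : Type u} [Ring B] [Module B U] [SMulCommClass B Aᵐᵒᵖ U]

variable (U B) in
/-- The `B`-linear map `U ⊗_A f` for a `(B, A)`-bimodule `U`. -/
def Tens.lmap (f : M →ₗ[A] N) : Tens A U M →ₗ[B] Tens A U N :=
  { Tens.map (LinearMap.id : U →ₗ[Aᵐᵒᵖ] U) f with
    map_smul' := fun b x => by
      change Tens.map LinearMap.id f (b • x) = b • Tens.map LinearMap.id f x
      induction x using Tens.induction with
      | h0 => simp
      | ht u m => rfl
      | ha x y hx hy => simp only [smul_add, map_add, hx, hy] }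

@[simp] theorem Tens.lmap_apply (f : M →ₗ[A] N) (x : Tens A U M) :
    Tens.lmap U B f x = Tens.map LinearMap.id f x := rfl

theorem Tens.projective (hM : Module.Projective A M) (hU : Module.Projective B U) :
    Module.Projective B (Tens A U M) := by
  obtain ⟨s, hs⟩ := hM.out
  let i : Tens A U M →ₗ[B] (M →₀ U) :=
    { Tens.coords s U with
      map_smul' := fun b x => by
        change Tens.coords s U (b • x) = b • Tens.coords s U x
        induction x using Tens.induction with
        | h0 => simp
        | ht u m => ext m'; simp [Tens.coords_tmul, smul_tmul, smul_comm]
        | ha x y hx hy => simp only [smul_add, map_add, hx, hy] }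
  let r : (M →₀ U) →ₗ[B] Tens A U M :=
    { Tens.ofCoords A U M with
      map_smul' := fun b x => by
        change Tens.ofCoords A U M (b • x) = b • Tens.ofCoords A U M x
        induction x using Finsupp.induction_linear with
        | zero => simp
        | single m u => rw [Finsupp.smul_single, Tens.ofCoords_single, Tens.ofCoords_single]; rfl
        | add x y hx hy => simp only [smul_add, map_add, hx, hy] }
  classical
  have : Module.Projective B (M →₀ U) := .of_equiv' (finsuppLequivDFinsupp B).symm
  exact Module.Projective.of_split i r (LinearMap.ext fun x => Tens.ofCoords_coords s hs x)

end Bimodule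

/-- If `U` has finite flat dimension, then `U ⊗_A -` preserves the exactness of complexes of
projectives. -/
theorem Tens.map_injective_of_hasResolution {X P : ℤ → ModuleCat.{u} A}
    {ι : ∀ i, X i →ₗ[A] P i} {π : ∀ i, P i →ₗ[A] X (i + 1)}
    (s : ∀ i, ProjectiveStep (X i) (P i) (X (i + 1)) (ι i) (π i)) (n : ℕ) :
    ∀ U : ModuleCat.{u} Aᵐᵒᵖ, HasResolution (IsRightFlat A) n U → ∀ i,
      Function.Injective (Tens.map (LinearMap.id : U →ₗ[Aᵐᵒᵖ] U) (ι i)) := by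
  induction n with
  | zero => exact fun U hU i => hU _ _ (ι i) (s i).injective
  | succ n ih =>
    rintro U ⟨F, g, hF, hg, hV⟩ i
    replace ih := ih _ hV
    let k : LinearMap.ker g →ₗ[Aᵐᵒᵖ] F := (LinearMap.ker g).subtype
    have hk : Function.Injective k := Subtype.val_injective
    have hkg : Function.Exact k g := fun x => ⟨fun hx => ⟨⟨x, hx⟩, rfl⟩, fun ⟨y, hy⟩ => hy ▸ y.2⟩
    refine (injective_iff_map_eq_zero _).2 fun x hx => ?_
    -- Diagram chase with `0 → V → F → U → 0`: lift `x` to `y` in `F ⊗ X i`; its image in `F ⊗ P i`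
    -- comes from some `z` in `V ⊗ P i`.
    obtain ⟨y, rfl⟩ := Tens.map_surjective hg (Function.surjective_id (α := X i))
      (f := LinearMap.id) x
    obtain ⟨z, hz⟩ := (Tens.exact_left hg hkg (P i) (Tens.map LinearMap.id (ι i) y)).1 (by
      rw [← hx]; simp only [Tens.map_map, LinearMap.id_comp, LinearMap.comp_id])
    -- The vanishing is detected in `F ⊗ P (i + 1)`: the induction hypothesis is used in degree `i +
    -- 1`, which is why the whole complex is carried along. Then `z` comes from `V ⊗ X i`, and
    -- flatness of `F` identifies its source with `y`.
    have hw : Tens.map (LinearMap.id : LinearMap.ker g →ₗ[Aᵐᵒᵖ] _) (π i) z = 0 := by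
      refine (injective_iff_map_eq_zero _).1 (ih (i + 1)) _ ?_
      refine (injective_iff_map_eq_zero _).1
        (Tens.map_injective_of_projective (s (i + 1)).projective k hk) _ ?_
      have : Tens.map (LinearMap.id : F →ₗ[Aᵐᵒᵖ] F) (ι (i + 1) ∘ₗ π i)
          (Tens.map k LinearMap.id z) = 0 := by
        rw [hz, Tens.map_map, LinearMap.comp_assoc, show π i ∘ₗ ι i = 0 from
          LinearMap.ext fun v => ((s i).exact _).2 ⟨v, rfl⟩, LinearMap.comp_zero,
          Tens.map_zero_right]
      rw [← this]
      simp only [Tens.map_map, LinearMap.id_comp, LinearMap.comp_id]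
    obtain ⟨z', rfl⟩ := (Tens.exact_right (s i).surjective (s i).exact _ z).1 hw
    have hy : y = Tens.map k LinearMap.id z' := by
      refine hF _ _ (ι i) (s i).injective ?_
      rw [← hz]
      simp only [Tens.map_map, LinearMap.id_comp, LinearMap.comp_id]
    exact (Tens.exact_left hg hkg (X i) y).2 ⟨z', hy.symm⟩

end TensorLemmas

/-! ### Corners of a module -/

section Corner

variable {S R : Type u} [Ring S] [Ring R] (ι : S →ₙ+* R)

/-- For a non-unital ring homomorphism `ι : S → R` with `e = ι 1`, the subgroup `e N` of an
`R`-module `N`, which is an `S`-module. -/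
def corner (N : Type u) [AddCommGroup N] [Module R N] : AddSubgroup N where
  carrier := {x | ι 1 • x = x}
  add_mem' {x y} hx hy := by simp_all
  zero_mem' := by simp
  neg_mem' {x} hx := by simp_all

variable {N N' : Type u} [AddCommGroup N] [Module R N] [AddCommGroup N'] [Module R N']

theorem mem_corner {x : N} : x ∈ corner ι N ↔ ι 1 • x = x := Iff.rfl

theorem smul_mem_corner (s : S) (x : N) : ι s • x ∈ corner ι N := by
  rw [mem_corner, smul_smul, ← map_mul, one_mul]

instance : Module S (corner ι N) where
  smul s x := ⟨ι s • (x : N), smul_mem_corner ι s _⟩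
  smul_zero s := Subtype.ext (smul_zero _)
  smul_add s x y := Subtype.ext (smul_add _ _ _)
  one_smul x := Subtype.ext x.2
  mul_smul s t x := Subtype.ext (by
    change ι (s * t) • (x : N) = ι s • ι t • (x : N)
    rw [map_mul, mul_smul])
  add_smul s t x := Subtype.ext (by
    change ι (s + t) • (x : N) = ι s • (x : N) + ι t • (x : N)
    rw [map_add, add_smul])
  zero_smul x := Subtype.ext (by
    change ι 0 • (x : N) = 0
    rw [map_zero, zero_smul])

@[simp] theorem coe_smul_corner (s : S) (x : corner ι N) : ((s • x : corner ι N) : N) =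
    ι s • (x : N) := rfl

/-- The map of corners induced by a map of modules. -/
def cornerMap (f : N →ₗ[R] N') : corner ι N →ₗ[S] corner ι N' where
  toFun x := ⟨f x, by rw [mem_corner, ← map_smul, (mem_corner ι).1 x.2]⟩
  map_add' x y := Subtype.ext (map_add f _ _)
  map_smul' s x := Subtype.ext (map_smul f _ _)

theorem cornerMap_surjective {f : N →ₗ[R] N'} (hf : Function.Surjective f) :
    Function.Surjective (cornerMap ι f) := by
  rintro ⟨y, hy⟩
  obtain ⟨x, rfl⟩ := hf y
  exact ⟨⟨ι 1 • x, smul_mem_corner ι 1 x⟩, Subtype.ext ((map_smul f _ _).trans hy)⟩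

/-- If `e R` is projective over `S`, then so is `e Q` for every projective `R`-module `Q`. -/
theorem projective_corner (hR : Module.Projective S (corner ι R)) {Q : Type u} [AddCommGroup Q]
    [Module R Q] (hQ : Module.Projective R Q) : Module.Projective S (corner ι Q) := by
  obtain ⟨sec, hsec⟩ := hQ.out
  let e : R →+ corner ι R :=
    { toFun := fun t => ⟨ι 1 • t, smul_mem_corner ι 1 t⟩
      map_zero' := Subtype.ext (smul_zero _)
      map_add' := fun x y => Subtype.ext (smul_add _ _ _) }
  -- A splitting of `R^(Q) → Q`, cut down by `e`, exhibits `e Q` as a retract of `(e R)^(Q)`.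
  let i : corner ι Q →ₗ[S] (Q →₀ corner ι R) :=
    { toFun := fun x => (sec x).mapRange e (map_zero e)
      map_add' := fun x y => by
        ext q
        simp
      map_smul' := fun s x => by
        ext q
        simp only [coe_smul_corner, map_smul, Finsupp.mapRange_apply, Finsupp.smul_apply,
          RingHom.id_apply]
        change ι 1 • ι s • sec x q = ι s • ι 1 • sec x q
        rw [smul_smul, smul_smul, ← map_mul, ← map_mul, one_mul, mul_one] }
  let r : (Q →₀ corner ι R) →ₗ[S] corner ι Q := Finsupp.lsum ℕ fun q =>
    { toFun := fun t => ⟨(t : R) • q, by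
        rw [mem_corner, smul_smul]; exact congrArg (· • q) t.2⟩
      map_add' := fun t t' => Subtype.ext (add_smul _ _ _)
      map_smul' := fun s t => Subtype.ext (mul_smul _ _ _) }
  have hr : ∀ q t, r (Finsupp.single q t) = (t : R) • q := fun q t => by simp [r]
  have key : ∀ y : Q →₀ R, (r (y.mapRange e (map_zero e)) : Q) =
      ι 1 • Finsupp.linearCombination R id y := by
    intro y
    induction y using Finsupp.induction_linear with
    | zero => simp
    | add x y hx hy =>
      rw [Finsupp.mapRange_add (map_add e), map_add, map_add, smul_add, ← hx, ← hy]
      rfl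
    | single q t =>
      rw [Finsupp.mapRange_single, hr, Finsupp.linearCombination_single, id, smul_smul]
      rfl
  classical
  have : Module.Projective S (Q →₀ corner ι R) := .of_equiv' (finsuppLequivDFinsupp S).symm
  refine Module.Projective.of_split i r (LinearMap.ext fun x => Subtype.ext ?_)
  exact (key _).trans ((congrArg _ (hsec x)).trans x.2)

end Corner

/-! ### Modules over the triangular matrix ring -/

section TriangularModules

variable {A B U : Type u} [Ring A] [Ring B] [AddCommGroup U] [Module B U] [Module Aᵐᵒᵖ U]
  [SMulCommClass B Aᵐᵒᵖ U]

variable (A B U) in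
/-- The upper left corner of the triangular matrix ring. -/
@[simps] def inclA : A →ₙ+* TriangularRing A B U where
  toFun a := ⟨a, 0, 0⟩
  map_mul' a b := by ext <;> simp
  map_zero' := rfl
  map_add' a b := by ext <;> simp

variable (A B U) in
/-- The lower right corner of the triangular matrix ring. -/
@[simps] def inclB : B →ₙ+* TriangularRing A B U where
  toFun b := ⟨0, 0, b⟩
  map_mul' a b := by ext <;> simp
  map_zero' := rfl
  map_add' a b := by ext <;> simp

/-- The corner is the first row `(a, 0)` of the matrix ring, a copy of `A`. -/
theorem projective_corner_inclA :
    Module.Projective A (corner (inclA A B U) (TriangularRing A B U)) := by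
  refine Module.Projective.of_split (M := A)
    { toFun := fun t => t.1.a
      map_add' := fun x y => rfl
      map_smul' := fun s x => by simp }
    { toFun := fun a => ⟨⟨a, 0, 0⟩, by rw [mem_corner]; ext <;> simp⟩
      map_add' := fun x y => by ext <;> simp
      map_smul' := fun s x => by ext <;> simp } ?_
  refine LinearMap.ext fun ⟨t, ht⟩ => ?_
  rw [mem_corner] at ht
  rw [TriangularRing.ext_iff] at ht
  ext <;> simp at ht ⊢ <;> simp [ht.1, ht.2]

/-- The corner is the second row `(u, b)`, that is `U × B`. -/
theorem projective_corner_inclB (hU : Module.Projective B U) :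
    Module.Projective B (corner (inclB A B U) (TriangularRing A B U)) := by
  refine Module.Projective.of_split (M := U × B)
    { toFun := fun t => (t.1.u, t.1.b)
      map_add' := fun x y => rfl
      map_smul' := fun s x => by ext <;> simp }
    { toFun := fun a => ⟨⟨0, a.1, a.2⟩, by rw [mem_corner]; ext <;> simp⟩
      map_add' := fun x y => by ext <;> simp
      map_smul' := fun s x => by ext <;> simp } ?_
  refine LinearMap.ext fun ⟨t, ht⟩ => ?_
  rw [mem_corner] at ht
  rw [TriangularRing.ext_iff] at ht
  ext <;> simp at ht ⊢
  simp [ht]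

variable {M₁ M₂ N₁ N₂ L₁ L₂ : Type u} [AddCommGroup M₁] [Module A M₁] [AddCommGroup M₂]
  [Module B M₂] [AddCommGroup N₁] [Module A N₁] [AddCommGroup N₂] [Module B N₂]

/-- The column `(m₁; m₂)`. -/
def column (φ : Tens A U M₁ →ₗ[B] M₂) (m₁ : M₁) (m₂ : M₂) : TriangularModule φ := (m₁, m₂)

section Column

variable (φ : Tens A U M₁ →ₗ[B] M₂)

theorem exists_column (x : TriangularModule φ) : ∃ m₁ m₂, x = column φ m₁ m₂ := ⟨x.1, x.2, rfl⟩

theorem column_eq_zero {m₁ : M₁} {m₂ : M₂} : column φ m₁ m₂ = 0 ↔ m₁ = 0 ∧ m₂ = 0 :=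
  Prod.mk_eq_zero

theorem column_add (m₁ m₁' : M₁) (m₂ m₂' : M₂) :
    column φ (m₁ + m₁') (m₂ + m₂') = column φ m₁ m₂ + column φ m₁' m₂' := rfl

theorem smul_column (t : TriangularRing A B U) (m₁ : M₁) (m₂ : M₂) :
    t • column φ m₁ m₂ = column φ (t.a • m₁) (φ (tmul A t.u m₁) + t.b • m₂) := rfl

theorem column_eq_add (m₁ : M₁) (m₂ : M₂) : column φ m₁ m₂ = column φ m₁ 0 + column φ 0 m₂ := by
  rw [← column_add, add_zero, zero_add]

/-- The `A`-linear inclusion of the first component. -/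
def columnFst : M₁ →ₗ[A] corner (inclA A B U) (TriangularModule φ) where
  toFun m := ⟨column φ m 0, by simp [mem_corner, smul_column, zero_tmul]⟩
  map_add' m m' := Subtype.ext (by
    change column φ (m + m') 0 = column φ m 0 + column φ m' 0
    rw [← column_add, add_zero])
  map_smul' a m := Subtype.ext (by
    change column φ (a • m) 0 = inclA A B U a • column φ m 0
    simp [smul_column, zero_tmul])

/-- The `B`-linear inclusion of the second component. -/
def columnSnd : M₂ →ₗ[B] corner (inclB A B U) (TriangularModule φ) where
  toFun m := ⟨column φ 0 m, by simp [mem_corner, smul_column, zero_tmul]⟩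
  map_add' m m' := Subtype.ext (by
    change column φ 0 (m + m') = column φ 0 m + column φ 0 m'
    rw [← column_add, add_zero])
  map_smul' a m := Subtype.ext (by
    change column φ 0 (a • m) = inclB A B U a • column φ 0 m
    simp [smul_column, zero_tmul])

variable {N : Type u} [AddCommGroup N] [Module (TriangularRing A B U) N]

/-- A map out of a triangular module is given by compatible maps on the two components. -/
def columnDesc (f : M₁ →ₗ[A] corner (inclA A B U) N) (g : M₂ →ₗ[B] corner (inclB A B U) N)
    (h : ∀ u m, (⟨0, u, 0⟩ : TriangularRing A B U) • (f m : N) = g (φ (tmul A u m))) :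
    TriangularModule φ →ₗ[TriangularRing A B U] N where
  toFun x := f x.1 + g x.2
  map_add' x y := by
    change ((f (x.1 + y.1) : corner _ _) : N) + (g (x.2 + y.2) : corner _ _) = _
    rw [map_add, map_add, AddSubgroup.coe_add, AddSubgroup.coe_add]
    abel
  map_smul' t x := by
    change ((f (t.a • x.1) : corner _ _) : N) + (g (φ (tmul A t.u x.1) + t.b • x.2) : corner _ _) =
      t • ((f x.1 : N) + g x.2)
    -- Elements of a corner absorb the idempotent, so only the first column of `t` acts here, and
    -- only the second column in `h2`.
    have h1 : t • (f x.1 : N) = inclA A B U t.a • (f x.1 : N) +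
        (⟨0, t.u, 0⟩ : TriangularRing A B U) • (f x.1 : N) := by
      conv_lhs => rw [← (mem_corner _).1 (f x.1).2]
      rw [smul_smul, ← add_smul]
      congr 1
      ext <;> simp
    have h2 : t • (g x.2 : N) = inclB A B U t.b • (g x.2 : N) := by
      conv_lhs => rw [← (mem_corner _).1 (g x.2).2]
      rw [smul_smul]
      congr 1
      ext <;> simp
    rw [smul_add, h1, h2, h, map_add, map_smul, map_smul, AddSubgroup.coe_add, coe_smul_corner,
      coe_smul_corner]
    abel

theorem columnDesc_column (f : M₁ →ₗ[A] corner (inclA A B U) N)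
    (g : M₂ →ₗ[B] corner (inclB A B U) N)
    (h : ∀ u m, (⟨0, u, 0⟩ : TriangularRing A B U) • (f m : N) = g (φ (tmul A u m)))
    (m₁ : M₁) (m₂ : M₂) : columnDesc φ f g h (column φ m₁ m₂) = f m₁ + g m₂ := rfl

end Column

/-- The map of triangular modules given by a compatible pair of maps. -/
def columnMap {φ : Tens A U M₁ →ₗ[B] M₂} {ψ : Tens A U N₁ →ₗ[B] N₂} (f : M₁ →ₗ[A] N₁)
    (g : M₂ →ₗ[B] N₂) (h : ∀ u m, g (φ (tmul A u m)) = ψ (tmul A u (f m))) :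
    TriangularModule φ →ₗ[TriangularRing A B U] TriangularModule ψ where
  toFun x := column ψ (f x.1) (g x.2)
  map_add' x y := by
    rw [← column_add, ← map_add, ← map_add]
    rfl
  map_smul' t x := by
    rw [RingHom.id_apply, smul_column, ← h, ← map_smul, ← map_smul, ← map_add]
    rfl

theorem columnMap_column {φ : Tens A U M₁ →ₗ[B] M₂} {ψ : Tens A U N₁ →ₗ[B] N₂} (f : M₁ →ₗ[A] N₁)
    (g : M₂ →ₗ[B] N₂) (h : ∀ u m, g (φ (tmul A u m)) = ψ (tmul A u (f m))) (m₁ : M₁) (m₂ : M₂) :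
    columnMap (φ := φ) (ψ := ψ) f g h (column φ m₁ m₂) = column ψ (f m₁) (g m₂) := rfl

theorem columnMap_injective {φ : Tens A U M₁ →ₗ[B] M₂} {ψ : Tens A U N₁ →ₗ[B] N₂}
    {f : M₁ →ₗ[A] N₁} {g : M₂ →ₗ[B] N₂} (h : ∀ u m, g (φ (tmul A u m)) = ψ (tmul A u (f m)))
    (hf : Function.Injective f) (hg : Function.Injective g) :
    Function.Injective (columnMap (φ := φ) (ψ := ψ) f g h) := fun _ _ hxy =>
  Prod.ext (hf (congrArg Prod.fst hxy)) (hg (congrArg Prod.snd hxy))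

theorem columnMap_surjective {φ : Tens A U M₁ →ₗ[B] M₂} {ψ : Tens A U N₁ →ₗ[B] N₂}
    {f : M₁ →ₗ[A] N₁} {g : M₂ →ₗ[B] N₂} (h : ∀ u m, g (φ (tmul A u m)) = ψ (tmul A u (f m)))
    (hf : Function.Surjective f) (hg : Function.Surjective g) :
    Function.Surjective (columnMap (φ := φ) (ψ := ψ) f g h) := fun x => by
  obtain ⟨a, ha⟩ := hf x.1
  obtain ⟨b, hb⟩ := hg x.2
  exact ⟨column φ a b, Prod.ext ha hb⟩

variable [AddCommGroup L₁] [Module A L₁] [AddCommGroup L₂] [Module B L₂]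

theorem columnMap_exact {φ : Tens A U M₁ →ₗ[B] M₂} {ψ : Tens A U N₁ →ₗ[B] N₂}
    {χ : Tens A U L₁ →ₗ[B] L₂} {f : M₁ →ₗ[A] N₁} {g : M₂ →ₗ[B] N₂}
    (h : ∀ u m, g (φ (tmul A u m)) = ψ (tmul A u (f m))) {f' : N₁ →ₗ[A] L₁} {g' : N₂ →ₗ[B] L₂}
    (h' : ∀ u m, g' (ψ (tmul A u m)) = χ (tmul A u (f' m)))
    (hf : Function.Exact f f') (hg : Function.Exact g g') :
    Function.Exact (columnMap (φ := φ) (ψ := ψ) f g h) (columnMap (φ := ψ) (ψ := χ) f' g' h') := by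
  intro x
  obtain ⟨m, n, rfl⟩ := exists_column _ x
  rw [columnMap_column, column_eq_zero, hf m, hg n]
  constructor
  · rintro ⟨⟨a, rfl⟩, ⟨b, rfl⟩⟩
    exact ⟨column φ a b, rfl⟩
  · rintro ⟨y, hy⟩
    exact ⟨⟨y.1, congrArg Prod.fst hy⟩, ⟨y.2, congrArg Prod.snd hy⟩⟩

/-! ### The induced modules `(X; U ⊗ X)` and `(0; Y)` -/

variable (A B U) in
/-- The module `(X; U ⊗_A X)`. -/
abbrev Induced (X : Type u) [AddCommGroup X] [Module A X] : Type u :=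
  TriangularModule (LinearMap.id : Tens A U X →ₗ[B] Tens A U X)

variable (A B U) in
/-- The module `(0; Y)`. -/
abbrev Inflated (Y : Type u) [AddCommGroup Y] [Module B Y] : Type u :=
  TriangularModule (0 : Tens A U PUnit.{u + 1} →ₗ[B] Y)

variable {X Y Z : Type u} [AddCommGroup X] [Module A X] [AddCommGroup Y] [Module B Y]
  [AddCommGroup Z] [Module A Z]
  {N N' : Type u} [AddCommGroup N] [Module (TriangularRing A B U) N]
  [AddCommGroup N'] [Module (TriangularRing A B U) N']

/-- The first component generates the module, as `(0; u ⊗ m) = (0 0; u 0) (m; 0)`. -/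
theorem induced_hom_ext {f g : Induced A B U X →ₗ[TriangularRing A B U] N}
    (h : ∀ x, f (column _ x 0) = g (column _ x 0)) : f = g := by
  refine LinearMap.ext fun x => ?_
  obtain ⟨x, w, rfl⟩ := exists_column _ x
  rw [column_eq_add, map_add, map_add, h]
  congr 1
  induction w using Tens.induction with
  | h0 => exact h 0
  | ht u m =>
    have : column (LinearMap.id : Tens A U X →ₗ[B] Tens A U X) 0 (tmul A u m) =
        (⟨0, u, 0⟩ : TriangularRing A B U) • column _ m 0 := by
      simp [smul_column]
    rw [this, map_smul, map_smul, h]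
  | ha v w hv hw =>
    have := column_add (LinearMap.id : Tens A U X →ₗ[B] Tens A U X) 0 0 v w
    rw [add_zero] at this
    rw [this, map_add, map_add, hv, hw]

/-- The biadditive map `(u, x) ↦ (0 0; u 0) f(x)`. -/
def cornerAction (f : X →ₗ[A] corner (inclA A B U) N) : U →+ X →+ corner (inclB A B U) N where
  toFun u :=
    { toFun := fun x => ⟨(⟨0, u, 0⟩ : TriangularRing A B U) • (f x : N), by
        rw [mem_corner, smul_smul]; congr 1; ext <;> simp⟩
      map_zero' := by ext; simp
      map_add' := fun x y => by ext; simp }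
  map_zero' := by
    ext x
    change (0 : TriangularRing A B U) • (f x : N) = 0
    simp
  map_add' u v := by
    ext x
    change (⟨0, u + v, 0⟩ : TriangularRing A B U) • (f x : N) =
      (⟨0, u, 0⟩ : TriangularRing A B U) • (f x : N) +
        (⟨0, v, 0⟩ : TriangularRing A B U) • (f x : N)
    rw [← add_smul]
    congr 1
    ext <;> simp

theorem coe_cornerAction (f : X →ₗ[A] corner (inclA A B U) N) (u : U) (x : X) :
    (cornerAction f u x : N) = (⟨0, u, 0⟩ : TriangularRing A B U) • (f x : N) := rfl

theorem cornerAction_op_smul (f : X →ₗ[A] corner (inclA A B U) N) (u : U) (a : A) (x : X) :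
    cornerAction f (op a • u) x = cornerAction f u (a • x) := Subtype.ext (by
  rw [coe_cornerAction, coe_cornerAction, map_smul, coe_smul_corner, smul_smul]
  congr 1
  ext <;> simp)

theorem cornerAction_smul (f : X →ₗ[A] corner (inclA A B U) N) (b : B) (u : U) (x : X) :
    cornerAction f (b • u) x = b • cornerAction f u x := Subtype.ext (by
  rw [coe_smul_corner, coe_cornerAction, coe_cornerAction, smul_smul]
  congr 1
  ext <;> simp)

/-- The map `U ⊗_A X → e N` sending `u ⊗ x` to `(0 0; u 0) f(x)`. -/
def cornerTens (f : X →ₗ[A] corner (inclA A B U) N) :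
    Tens A U X →ₗ[B] corner (inclB A B U) N where
  toFun := Tens.lift (cornerAction f) (cornerAction_op_smul f)
  map_add' := map_add _
  map_smul' b w := by
    rw [RingHom.id_apply]
    induction w using Tens.induction with
    | h0 => rw [smul_zero, map_zero, smul_zero]
    | ht u x => exact cornerAction_smul f b u x
    | ha v w hv hw => rw [smul_add, map_add, map_add, hv, hw, smul_add]

/-- The map `(X; U ⊗_A X) → N` induced by a map on `X`. -/
def inducedDesc (f : X →ₗ[A] corner (inclA A B U) N) :
    Induced A B U X →ₗ[TriangularRing A B U] N :=
  columnDesc _ f (cornerTens f) (fun _ _ => rfl)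

theorem inducedDesc_column (f : X →ₗ[A] corner (inclA A B U) N) (x : X) :
    inducedDesc f (column _ x 0) = f x :=
  (columnDesc_column _ _ _ _ _ _).trans (by rw [map_zero, AddSubgroup.coe_zero, add_zero])

theorem inflated_hom_ext {f g : Inflated A B U Y →ₗ[TriangularRing A B U] N}
    (h : ∀ y, f (column _ 0 y) = g (column _ 0 y)) : f = g :=
  LinearMap.ext fun x => h x.2

/-- The map `(0; Y) → N` induced by a map on `Y`. -/
def inflatedDesc (f : Y →ₗ[B] corner (inclB A B U) N) :
    Inflated A B U Y →ₗ[TriangularRing A B U] N :=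
  columnDesc _ 0 f (fun u m => by simp)

theorem inflatedDesc_column (f : Y →ₗ[B] corner (inclB A B U) N) (y : Y) :
    inflatedDesc f (column _ 0 y) = f y := by
  rw [inflatedDesc, columnDesc_column]
  simp

/-- Maps from `(X; U ⊗ X)` to `N` correspond to `A`-linear maps from `X` to the corner of `N`, and
passing to corners preserves surjections. -/
theorem projective_induced (hX : Module.Projective A X) :
    Module.Projective (TriangularRing A B U) (Induced A B U X) := by
  refine Module.Projective.of_lifting_property.{u, u} fun f g hf => ?_
  obtain ⟨k, hk⟩ := Module.projective_lifting_property (cornerMap (inclA A B U) f)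
    (cornerMap (inclA A B U) g ∘ₗ columnFst _) (cornerMap_surjective _ hf)
  refine ⟨inducedDesc k, induced_hom_ext fun x => ?_⟩
  rw [LinearMap.comp_apply, inducedDesc_column]
  exact congrArg Subtype.val (LinearMap.congr_fun hk x)

theorem projective_inflated (hY : Module.Projective B Y) :
    Module.Projective (TriangularRing A B U) (Inflated A B U Y) := by
  refine Module.Projective.of_lifting_property.{u, u} fun f g hf => ?_
  obtain ⟨k, hk⟩ := Module.projective_lifting_property (cornerMap (inclB A B U) f)
    (cornerMap (inclB A B U) g ∘ₗ columnSnd _) (cornerMap_surjective _ hf)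
  refine ⟨inflatedDesc k, inflated_hom_ext fun x => ?_⟩
  rw [LinearMap.comp_apply, inflatedDesc_column]
  exact congrArg Subtype.val (LinearMap.congr_fun hk x)

end TriangularModules

/-! ### Gorenstein projective columns and the induction on the dimension -/

section MainProof

variable {A B U : Type u} [Ring A] [Ring B] [AddCommGroup U] [Module B U] [Module Aᵐᵒᵖ U]
  [SMulCommClass B Aᵐᵒᵖ U]

theorem IsGorensteinProjective.inflated (hU : Module.Projective B U) {Y : ModuleCat.{u} B}
    (hY : IsGorensteinProjective Y) :
    IsGorensteinProjective (ModuleCat.of (TriangularRing A B U) (Inflated A B U Y)) := by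
  obtain ⟨X, hX, ⟨e⟩⟩ := hY.exists_family
  have e' : Inflated A B U Y ≃ₗ[TriangularRing A B U] Inflated A B U (X 0) :=
    LinearEquiv.ofBijective (columnMap LinearMap.id e.toLinearMap (by simp))
      ⟨columnMap_injective _ Function.injective_id e.injective,
        columnMap_surjective _ Function.surjective_id e.surjective⟩
  refine .of_family (fun i => ModuleCat.of _ (Inflated A B U (X i))) (fun i => ?_) _ e'
  obtain ⟨P, ι, π, s, hext⟩ := hX i
  refine ⟨ModuleCat.of _ (Inflated A B U P), columnMap LinearMap.id ι (by simp),
    columnMap 0 π (by simp), ⟨projective_inflated s.projective,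
      columnMap_injective _ Function.injective_id s.injective,
      columnMap_surjective _ (fun x => ⟨0, rfl⟩) s.surjective,
      columnMap_exact _ _ (fun x => by simp) s.exact⟩, fun Q hQ g => ?_⟩
  -- By adjunction, extending `g` amounts to extending a `B`-linear map into the corner of `Q`,
  -- which is projective because `U` is.
  obtain ⟨h, hh⟩ := hext (ModuleCat.of B (corner (inclB A B U) Q))
    (projective_corner _ (projective_corner_inclB hU) hQ) (cornerMap _ g ∘ₗ columnSnd _)
  refine ⟨inflatedDesc h, LinearMap.congr_fun (f := inflatedDesc h ∘ₗ columnMap _ _ _) (g := g)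
    (inflated_hom_ext fun y => ?_)⟩
  rw [LinearMap.comp_apply, columnMap_column, LinearMap.id_apply, inflatedDesc_column, hh]
  rfl

theorem IsGorensteinProjective.induced (hU : rightFlatDim A U < ⊤) {X : ModuleCat.{u} A}
    (hX : IsGorensteinProjective X) :
    IsGorensteinProjective (ModuleCat.of (TriangularRing A B U) (Induced A B U X)) := by
  obtain ⟨Y, hY, ⟨e⟩⟩ := hX.exists_family
  obtain ⟨n, hn⟩ := exists_hasResolution_of_lt_top hU
  choose P ι π s hext using hY
  -- The cycles need not be flat; finite flat dimension of `U` is what keeps `U ⊗ -` exact on this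
  -- complex.
  have hinj := Tens.map_injective_of_hasResolution s n _ hn
  have hid : Function.Surjective (LinearMap.id : U →ₗ[Aᵐᵒᵖ] U) := Function.surjective_id
  have e' : Induced A B U X ≃ₗ[TriangularRing A B U] Induced A B U (Y 0) :=
    LinearEquiv.ofBijective (columnMap e.toLinearMap (Tens.lmap U B e.toLinearMap)
      (fun _ _ => rfl))
      ⟨columnMap_injective _ e.injective fun x y hxy => by
          have := congrArg (Tens.map LinearMap.id e.symm.toLinearMap) hxy
          simpa [Tens.map_map, Tens.map_id] using this,
        columnMap_surjective _ e.surjective (Tens.map_surjective hid e.surjective)⟩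
  refine .of_family (fun i => ModuleCat.of _ (Induced A B U (Y i))) (fun i => ?_) _ e'
  refine ⟨ModuleCat.of _ (Induced A B U (P i)),
    columnMap (ι i) (Tens.lmap U B (ι i)) (fun _ _ => rfl),
    columnMap (π i) (Tens.lmap U B (π i)) (fun _ _ => rfl), ⟨projective_induced (s i).projective,
      columnMap_injective _ (s i).injective (hinj i),
      columnMap_surjective _ (s i).surjective (Tens.map_surjective hid (s i).surjective),
      columnMap_exact _ _ (s i).exact (Tens.exact_right (s i).surjective (s i).exact U)⟩,
    fun Q hQ g => ?_⟩
  obtain ⟨h, hh⟩ := hext i (ModuleCat.of A (corner (inclA A B U) Q))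
    (projective_corner _ projective_corner_inclA hQ) (cornerMap _ g ∘ₗ columnFst _)
  refine ⟨inducedDesc h, LinearMap.congr_fun (f := inducedDesc h ∘ₗ columnMap _ _ _) (g := g)
    (induced_hom_ext fun y => ?_)⟩
  change inducedDesc h (column LinearMap.id (ι i y) (Tens.lmap U B (ι i) 0)) = _
  rw [map_zero, inducedDesc_column, hh]
  rfl

theorem IsGorensteinProjective.tens (hB : IsLeftGorensteinRegular B)
    (hBU : Module.Projective B U) (hU : rightFlatDim A U < ⊤) {X : ModuleCat.{u} A}
    (hX : IsGorensteinProjective X) : IsGorensteinProjective (ModuleCat.of B (Tens A U X)) := by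
  obtain ⟨Y, hY, ⟨e⟩⟩ := hX.exists_family
  obtain ⟨n, hn⟩ := exists_hasResolution_of_lt_top hU
  choose P ι π s hext using hY
  have hinj := Tens.map_injective_of_hasResolution s n _ hn
  have hid : Function.Surjective (LinearMap.id : U →ₗ[Aᵐᵒᵖ] U) := Function.surjective_id
  have e' : Tens A U (Y 0) ≃ₗ[B] Tens A U X :=
    LinearEquiv.ofBijective (Tens.lmap U B e.symm.toLinearMap)
      ⟨fun x y hxy => by
          have := congrArg (Tens.map LinearMap.id e.toLinearMap) hxy
          simpa [Tens.map_map, Tens.map_id] using this,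
        Tens.map_surjective hid e.symm.surjective⟩
  exact (hB.isGorensteinProjective (X := fun i => ModuleCat.of B (Tens A U (Y i)))
    (P := fun i => ModuleCat.of B (Tens A U (P i))) (ι := fun i => Tens.lmap U B (ι i))
    (π := fun i => Tens.lmap U B (π i)) (fun i => ⟨Tens.projective (s i).projective hBU, hinj i,
      Tens.map_surjective hid (s i).surjective,
      Tens.exact_right (s i).surjective (s i).exact U⟩)).of_equiv e'

/-- The module `(G; (U ⊗_A G) ⊕ Q)`. -/
abbrev Cover (A B U G Q : Type u) [Ring A] [Ring B] [AddCommGroup U] [Module B U] [Module Aᵐᵒᵖ U]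
    [SMulCommClass B Aᵐᵒᵖ U] [AddCommGroup G] [Module A G] [AddCommGroup Q] [Module B Q] :
    Type u :=
  TriangularModule (LinearMap.inl B (Tens A U G) Q)

/-- The cover is an extension of `(0; Q)` by `(G; U ⊗ G)`. -/
theorem IsGorensteinProjective.cover (hBU : Module.Projective B U) (hU : rightFlatDim A U < ⊤)
    {G : ModuleCat.{u} A} {Q : ModuleCat.{u} B} (hG : IsGorensteinProjective G)
    (hQ : IsGorensteinProjective Q) :
    IsGorensteinProjective (ModuleCat.of (TriangularRing A B U) (Cover A B U G Q)) :=
  IsGorensteinExtension.isGorensteinProjective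
    ⟨ModuleCat.of _ (Induced A B U G), ModuleCat.of _ (Inflated A B U Q),
      columnMap LinearMap.id (LinearMap.inl B _ _) (fun _ _ => rfl),
      columnMap 0 (LinearMap.snd B _ _) (fun _ _ => rfl), hG.induced hU, hQ.inflated hBU,
      columnMap_injective _ Function.injective_id LinearMap.inl_injective,
      columnMap_surjective _ (fun x => ⟨0, rfl⟩) LinearMap.snd_surjective,
      columnMap_exact _ _ (fun x => by simp) .inl_snd⟩

theorem nonempty_equiv_ker {R : Type*} [Ring R] {K P M : Type*} [AddCommGroup K] [Module R K]
    [AddCommGroup P] [Module R P] [AddCommGroup M] [Module R M] {i : K →ₗ[R] P} {p : P →ₗ[R] M}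
    (hi : Function.Injective i) (h : Function.Exact i p) : Nonempty (K ≃ₗ[R] LinearMap.ker p) :=
  ⟨(LinearEquiv.ofInjective i hi).trans (LinearEquiv.ofEq _ _ (LinearMap.exact_iff.1 h).symm)⟩

theorem HasResolution.triangularModule (hB : IsLeftGorensteinRegular B)
    (hBU : Module.Projective B U) (hU : rightFlatDim A U < ⊤) (n : ℕ) :
    ∀ (M₁ : ModuleCat.{u} A) (M₂ : ModuleCat.{u} B) (φ : Tens A U M₁ →ₗ[B] M₂),
      HasResolution IsGorensteinProjective n M₁ → HasResolution IsGorensteinProjective n M₂ →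
      HasResolution IsGorensteinProjective (n + 1)
        (ModuleCat.of (TriangularRing A B U) (TriangularModule φ)) := by
  have hiso : ∀ X Y : ModuleCat.{u} (TriangularRing A B U), (X ≃ₗ[TriangularRing A B U] Y) →
      IsGorensteinProjective X → IsGorensteinProjective Y := fun _ _ e h => h.of_equiv e
  induction n with
  | zero =>
    intro M₁ M₂ φ h₁ h₂
    let p : Cover A B U M₁ M₂ →ₗ[TriangularRing A B U] TriangularModule φ :=
      columnMap LinearMap.id (φ.coprod LinearMap.id) (fun u m => by simp)
    -- The kernel of `(w, y) ↦ φ w + y` is the graph of `-φ`, a copy of `U ⊗ M₁`.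
    let i : Inflated A B U (Tens A U M₁) →ₗ[TriangularRing A B U] Cover A B U M₁ M₂ :=
      columnMap 0 (LinearMap.id.prod (-φ)) (fun u m => by simp [tmul_zero])
    obtain ⟨e⟩ := nonempty_equiv_ker (i := i) (p := p)
      (columnMap_injective _ (fun _ _ _ => rfl) fun x y hxy => congrArg Prod.fst hxy)
      (columnMap_exact _ _ (fun x => by simp [eq_comm]) fun ⟨x, y⟩ => by
        simp only [LinearMap.coprod_apply, LinearMap.id_apply]
        exact ⟨fun h => ⟨x, Prod.ext rfl (neg_eq_of_add_eq_zero_right h)⟩, by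
          rintro ⟨z, hz⟩
          obtain rfl : z = x := congrArg Prod.fst hz
          obtain rfl : -φ z = y := congrArg Prod.snd hz
          exact add_neg_cancel _⟩)
    exact ⟨ModuleCat.of _ (Cover A B U M₁ M₂), p, IsGorensteinProjective.cover hBU hU h₁ h₂,
      columnMap_surjective _ Function.surjective_id fun y => ⟨(0, y), by simp⟩,
      ((IsGorensteinProjective.tens hB hBU hU h₁).inflated hBU).of_equiv e⟩
  | succ n ih =>
    rintro M₁ M₂ φ ⟨G, f, hG, hf, h₁⟩ ⟨Q, g, hQ, hg, h₂⟩
    let κ : Tens A U G × Q →ₗ[B] M₂ := (φ ∘ₗ Tens.lmap U B f).coprod g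
    let p : Cover A B U G Q →ₗ[TriangularRing A B U] TriangularModule φ :=
      columnMap f κ (fun u m => by simp [κ, Tens.map_tmul])
    let ψ : Tens A U (LinearMap.ker f) →ₗ[B] LinearMap.ker κ :=
      (LinearMap.inl B _ _ ∘ₗ Tens.lmap U B (LinearMap.ker f).subtype).codRestrict _ (fun x => by
        have : f ∘ₗ (LinearMap.ker f).subtype = 0 := LinearMap.ext fun y => y.2
        simp [κ, Tens.map_map, this, Tens.map_zero_right])
    let i : TriangularModule ψ →ₗ[TriangularRing A B U] Cover A B U G Q :=
      columnMap (LinearMap.ker f).subtype (LinearMap.ker κ).subtype (fun u m => rfl)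
    obtain ⟨e⟩ := nonempty_equiv_ker (i := i) (p := p)
      (columnMap_injective _ Subtype.val_injective Subtype.val_injective)
      (columnMap_exact _ _ (LinearMap.exact_subtype_ker_map f) (LinearMap.exact_subtype_ker_map κ))
    refine ⟨ModuleCat.of _ (Cover A B U G Q), p, IsGorensteinProjective.cover hBU hU hG hQ,
      columnMap_surjective _ hf fun y => ?_, ?_⟩
    · obtain ⟨x, rfl⟩ := hg y
      exact ⟨(0, x), by simp [κ]⟩
    · refine HasResolution.of_equiv hiso _ e
        (ih (ModuleCat.of A (LinearMap.ker f)) (ModuleCat.of B (LinearMap.ker κ)) ψ h₁ ?_)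
      -- Projecting `ker κ` to `U ⊗ G` is onto because `g` is, and its kernel is `ker g`. So `ker κ`
      -- inherits the resolution length of `ker g`.
      refine HasResolution.extension n (L := ModuleCat.of B (LinearMap.ker g))
        (H := ModuleCat.of B (Tens A U G))
        ((LinearMap.inr B _ _ ∘ₗ (LinearMap.ker g).subtype).codRestrict _ (fun x => by
          simp [κ]))
        (LinearMap.fst B _ _ ∘ₗ (LinearMap.ker κ).subtype) ?_ ?_ ?_
        (IsGorensteinProjective.tens hB hBU hU hG) h₂
      · intro x y hxy
        exact Subtype.ext (congrArg (fun z : LinearMap.ker κ => (z : Tens A U G × Q).2) hxy)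
      · intro w
        obtain ⟨q, hq⟩ := hg (-φ (Tens.lmap U B f w))
        exact ⟨⟨(w, q), by simp [κ, hq]⟩, rfl⟩
      · rintro ⟨⟨w, q⟩, hwq⟩
        constructor
        · rintro rfl
          exact ⟨⟨q, by simpa [κ] using hwq⟩, rfl⟩
        · rintro ⟨y, hy⟩
          exact (congrArg (fun z : LinearMap.ker κ => (z : Tens A U G × Q).1) hy).symm

end MainProof

end GorensteinTriangular

theorem proposition2p10 {A B U : Type u} [Ring A] [Ring B]
    [AddCommGroup U] [Module B U] [Module Aᵐᵒᵖ U] [SMulCommClass B Aᵐᵒᵖ U]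
    (hUA : rightFlatDim A U < ⊤)
    (hB : IsLeftGorensteinRegular B)
    (hBU : Module.Projective B U)
    {M₁ M₂ : Type u} [AddCommGroup M₁] [Module A M₁] [AddCommGroup M₂] [Module B M₂]
    (φ : Tens A U M₁ →ₗ[B] M₂)
    (hpd : projectiveDimension (ModuleCat.of B (Tens A U M₁)) < ⊤)
    (n : ℕ) (hM₁ : Gpd A M₁ ≤ n) (hM₂ : Gpd B M₂ ≤ n) :
    Gpd (TriangularRing A B U) (TriangularModule φ) ≤ n + 1 := by
  have h₁ := (resolutionDim_le_iff IsGorensteinProjective.of_subsingleton).1 hM₁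
  have h₂ := (resolutionDim_le_iff IsGorensteinProjective.of_subsingleton).1 hM₂
  exact (resolutionDim_le_iff (n := n + 1) IsGorensteinProjective.of_subsingleton).2
    (HasResolution.triangularModule hB hBU hUA n _ _ φ h₁ h₂)
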